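/- Let $n\ge 1$, let $\Omega\subset\mathbb R^n$ be a bounded domain with Lipschitz boundary, and let $\sigma$ be the $(n-1)$-dimensional Hausdorff measure on $\partial\Omega$. Let $\kappa>0$ and let $m$ be a measurable function on $\Omega$ with $-1\le m\le\kappa$ a.e. and $0<|\{x\in\Omega: m(x)>0\}|<|\Omega|$. For a bounded measurable (for instance piecewise continuous) function $\beta:\partial\Omega\to\mathbb R$, a number $\lambda\in\mathbb R$ is called a principal eigenvalue of $$\Delta\phi+\lambda m\phi=0\ \text{ in }\Omega,\qquad \partial_{\mathbf n}\phi+\beta\phi=0\ \text{ on }\partial\Omega,$$ with positive eigenfunction $\phi$, if $\phi\in H^1(\Omega)$, $\phi>0$ a.e. in $\Omega$, and $$\int_\Omega\nabla\phi\cdot\nabla\psi+\int_{\partial\Omega}\beta\,\phi\,\psi\,d\sigma=\lambda\int_\Omega m\,\phi\,\psi\qquad\text{for all }\psi\in H^1(\Omega),$$ where the boundary values are traces. Let $\beta_1,\beta_2:\partial\Omega\to\mathbb R$ be bounded and measurable, and let $\lambda_1,\lambda_2$ be principal eigenvalues, with positive eigenfunctions $\phi_1,\phi_2$, of this problem with $\beta=\beta_1$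 and $\beta=\beta_2$, respectively. Suppose that $\int_\Omega m\phi_1^2>0$ and that $\beta_1\ge\beta_2$ $\sigma$-a.e. on $\partial\Omega$. Then $\lambda_1\ge\lambda_2$. If, in addition, the set of points of $\partial\Omega$ at which $\beta_1>\beta_2$ and the trace of $\phi_1$ is nonzero has positive $\sigma$-measure (in particular, if $\beta_1>\beta_2$ on $\partial\Omega$ and the trace of $\phi_1$ is not $\sigma$-a.e. zero), then $\lambda_1>\lambda_2$. -/

import Mathlib

open MeasureTheory Filter Topology
open scoped ContDiff Gradient

noncomputable section

/-- The boundary of `Ω` is locally the graph of a Lipschitz function, with `Ω` on one side: near each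
boundary point there are a unit vector `e` (the local "vertical" direction) and a Lipschitz function
`γ` of the component of `x` orthogonal to `e` such that `Ω` is the region strictly above the graph. -/
def HasLipschitzBoundary {n : ℕ} (Ω : Set (EuclideanSpace ℝ (Fin n))) : Prop :=
  ∀ x₀ ∈ frontier Ω, ∃ (e : EuclideanSpace ℝ (Fin n)) (K : NNReal)
    (γ : EuclideanSpace ℝ (Fin n) → ℝ), ‖e‖ = 1 ∧ LipschitzWith K γ ∧
      ∃ U ∈ 𝓝 x₀, ∀ x ∈ U, x ∈ Ω ↔ γ (x - inner ℝ e x • e) < inner ℝ e x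

/-- A bounded domain (nonempty connected open set) in `ℝⁿ` with Lipschitz boundary. -/
structure IsBoundedLipschitzDomain {n : ℕ} (Ω : Set (EuclideanSpace ℝ (Fin n))) : Prop where
  isOpen : IsOpen Ω
  isConnected : IsConnected Ω
  isBounded : Bornology.IsBounded Ω
  lipschitz : HasLipschitzBoundary Ω

/-- The surface measure on `∂Ω`: the `(n - 1)`-dimensional Hausdorff measure (Euclidean
normalisation) restricted to `∂Ω`. -/
def surfaceMeasure {n : ℕ} (Ω : Set (EuclideanSpace ℝ (Fin n))) :
    Measure (EuclideanSpace ℝ (Fin n)) :=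
  (Measure.euclideanHausdorffMeasure (n - 1)).restrict (frontier Ω)

/-- `u` belongs to the Sobolev space `H¹(Ω)` and `g` is its weak gradient. -/
structure HasH1Gradient {n : ℕ} (Ω : Set (EuclideanSpace ℝ (Fin n)))
    (u : EuclideanSpace ℝ (Fin n) → ℝ)
    (g : EuclideanSpace ℝ (Fin n) → EuclideanSpace ℝ (Fin n)) : Prop where
  memLp : MemLp u 2 (volume.restrict Ω)
  memLp_gradient : MemLp g 2 (volume.restrict Ω)
  integral_eq : ∀ η : EuclideanSpace ℝ (Fin n) → ℝ, ContDiff ℝ ∞ η → HasCompactSupport η →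
    tsupport η ⊆ Ω → ∀ w : EuclideanSpace ℝ (Fin n),
      ∫ x in Ω, u x * inner ℝ (∇ η x) w = -∫ x in Ω, inner ℝ (g x) w * η x

/-- `t ∈ L²(∂Ω)` is the trace of `u ∈ H¹(Ω)`: there are functions `f k`, smooth up to the
boundary, with `f k → u` in `H¹(Ω)` and `f k|_∂Ω → t` in `L²(∂Ω)`. On a bounded Lipschitz domain
every `u ∈ H¹(Ω)` has exactly one trace up to null sets of the surface measure. -/
def IsTrace {n : ℕ} (Ω : Set (EuclideanSpace ℝ (Fin n)))
    (u t : EuclideanSpace ℝ (Fin n) → ℝ) : Prop :=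
  MemLp t 2 (surfaceMeasure Ω) ∧
  ∃ g, HasH1Gradient Ω u g ∧ ∃ f : ℕ → EuclideanSpace ℝ (Fin n) → ℝ,
    (∀ k, ContDiff ℝ ∞ (f k)) ∧
    Tendsto (fun k => eLpNorm (fun x => f k x - u x) 2 (volume.restrict Ω)) atTop (𝓝 0) ∧
    Tendsto (fun k => eLpNorm (fun x => ∇ (f k) x - g x) 2 (volume.restrict Ω)) atTop (𝓝 0) ∧
    Tendsto (fun k => eLpNorm (fun x => f k x - t x) 2 (surfaceMeasure Ω)) atTop (𝓝 0)

/-- `φ ∈ H¹(Ω)` is a weak solution of the Robin problem `Δφ + Λ m φ = 0` in `Ω`,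
`∂ₙφ + β φ = 0` on `∂Ω`: for every `ψ ∈ H¹(Ω)`,
`∫_Ω ∇φ · ∇ψ + ∫_∂Ω β φ ψ = Λ ∫_Ω m φ ψ`, boundary values being taken in the sense of traces. -/
def IsWeakRobinSolution {n : ℕ} (Ω : Set (EuclideanSpace ℝ (Fin n)))
    (m β : EuclideanSpace ℝ (Fin n) → ℝ) (Λ : ℝ) (φ : EuclideanSpace ℝ (Fin n) → ℝ) : Prop :=
  ∃ g t, HasH1Gradient Ω φ g ∧ IsTrace Ω φ t ∧
    ∀ ψ g' t', HasH1Gradient Ω ψ g' → IsTrace Ω ψ t' →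
      (∫ x in Ω, inner ℝ (g x) (g' x)) + (∫ x, β x * t x * t' x ∂(surfaceMeasure Ω))
        = Λ * ∫ x in Ω, m x * φ x * ψ x

/-- `Λ` is a principal eigenvalue of the Robin problem with weight `m` and parameter `β`, and `φ` is
a positive eigenfunction associated with it. -/
structure IsPrincipalEigenpair {n : ℕ} (Ω : Set (EuclideanSpace ℝ (Fin n)))
    (m β : EuclideanSpace ℝ (Fin n) → ℝ) (Λ : ℝ) (φ : EuclideanSpace ℝ (Fin n) → ℝ) : Prop where
  weak_solution : IsWeakRobinSolution Ω m β Λ φ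
  pos : ∀ᵐ x ∂(volume.restrict Ω), 0 < φ x

/-- A bounded measurable weight with `-1 ≤ m ≤ κ` a.e. in `Ω` that changes sign, in the sense that
`0 < |{x ∈ Ω : m x > 0}| < |Ω|`. -/
structure IsIndefiniteWeight {n : ℕ} (Ω : Set (EuclideanSpace ℝ (Fin n)))
    (m : EuclideanSpace ℝ (Fin n) → ℝ) (κ : ℝ) : Prop where
  aemeasurable : AEMeasurable m (volume.restrict Ω)
  bounds : ∀ᵐ x ∂(volume.restrict Ω), -1 ≤ m x ∧ m x ≤ κ
  pos_measure : 0 < volume {x ∈ Ω | 0 < m x}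
  lt_measure : volume {x ∈ Ω | 0 < m x} < volume Ω

end

/-! The comparison rests on Picone's inequality. If the Robin problem with data `β`, `Λ` has a
positive solution, then Λ∫mu² ≤ ∫|∇u|² + ∫βτ² for every u in H¹(Ω) with trace τ
(`IsPositiveRobinSolution.picone`). Apply it to the second problem with u = φ₁, whose trace is t₁,
and test the first equation with φ₁ itself. The gradient terms cancel, leaving ∫(β₁ - β₂)t₁² ≤ (Λ₁ -
Λ₂)∫mφ₁². Since ∫mφ₁² > 0, both the weak and the strict inequality follow.

For smooth q, Picone's inequality comes from testing the equation of φ with q²/(φ + ε). With v =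
q∇φ/(φ + ε), the gradient term is 2v·∇q - |v|² ≤ |∇q|². As ε → 0 the factor φ/(φ + ε) tends to 1
because φ > 0; on the boundary t/(t + ε) tends to 1 only where the trace t is positive. Density then
gives all u.

The delicate point is therefore that t > 0 almost everywhere on ∂Ω
(`IsPositiveRobinSolution.trace_pos`). Taking q = 1 bounds ∇log(φ + ε) in L² uniformly in ε. Choose
c → 0 and ε → 0 with c log ε = -1: then c log(φ + ε) tends to 0 in W^{1,1}, while its trace equals
-1 wherever t = 0. The trace inequality `exists_eLpNorm_trace_le` forces {t = 0} to be null. That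
inequality is proved in local graph coordinates by integrating along segments that enter Ω; it also
gives finiteness of the surface measure and uniqueness of traces. -/

/-! ### The W^{1,1} trace inequality for smooth functions -/

/-- A Lipschitz parametrisation does not increase Hausdorff measure by more than a constant. -/
theorem restrict_range_euclideanHausdorffMeasure_le {d : ℕ} {X : Type*} [EMetricSpace X]
    [MeasurableSpace X] [BorelSpace X] {L : NNReal} {Γ : EuclideanSpace ℝ (Fin d) → X}
    (hΓ : LipschitzWith L Γ) {s : Set X} (hs : s ⊆ Set.range Γ) :
    (Measure.euclideanHausdorffMeasure d).restrict s ≤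
      ((L : ENNReal) ^ d) • (volume : Measure (EuclideanSpace ℝ (Fin d))).map Γ := by
  refine Measure.le_iff.2 fun A hA => ?_
  rw [Measure.restrict_apply hA, Measure.smul_apply,
    Measure.map_apply hΓ.continuous.measurable hA]
  have h1 : A ∩ s ⊆ Γ '' (Γ ⁻¹' A) := by
    rintro x ⟨hxA, hxs⟩
    obtain ⟨y, rfl⟩ := hs hxs
    exact ⟨y, hxA, rfl⟩
  refine (measure_mono h1).trans ?_
  have h2 := hΓ.hausdorffMeasure_image_le (d := d) (Nat.cast_nonneg d) (Γ ⁻¹' A)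
  -- Both sides carry the same normalising constant, so the bound for the unnormalised Hausdorff
  -- measure is enough.
  rw [← EuclideanSpace.euclideanHausdorffMeasure_eq_volume d,
    Measure.euclideanHausdorffMeasure_def, Measure.euclideanHausdorffMeasure_def,
    Measure.smul_apply, Measure.smul_apply, ENNReal.smul_def, ENNReal.smul_def, smul_eq_mul,
    smul_eq_mul, smul_eq_mul, mul_left_comm]
  gcongr
  rw [← ENNReal.rpow_natCast]
  exact h2

/-- Orthonormal coordinates on the hyperplane orthogonal to a unit vector. -/
theorem exists_linearIsometry_orthogonal {d : ℕ} {e : EuclideanSpace ℝ (Fin (d + 1))}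
    (he : ‖e‖ = 1) :
    ∃ ι : EuclideanSpace ℝ (Fin d) →ₗᵢ[ℝ] EuclideanSpace ℝ (Fin (d + 1)),
      (∀ y, inner ℝ e (ι y) = 0) ∧ ∀ x, ∃ y, ι y = x - inner ℝ e x • e := by
  have : Fact (Module.finrank ℝ (EuclideanSpace ℝ (Fin (d + 1))) = d + 1) := ⟨by simp⟩
  have he0 : e ≠ 0 := by
    rintro rfl
    simp at he
  let B := OrthonormalBasis.fromOrthogonalSpanSingleton (𝕜 := ℝ) d he0
  refine ⟨(Submodule.subtypeₗᵢ _).comp B.repr.symm.toLinearIsometry, fun y => ?_, fun x => ?_⟩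
  · exact Submodule.mem_orthogonal_singleton_iff_inner_right.1 (B.repr.symm y).2
  · have hx : x - inner ℝ e x • e ∈ (Submodule.span ℝ {e})ᗮ := by
      rw [Submodule.mem_orthogonal_singleton_iff_inner_right, inner_sub_right, inner_smul_right,
        real_inner_self_eq_norm_sq, he]
      ring
    refine ⟨B.repr ⟨_, hx⟩, ?_⟩
    simp

/-- The map (y, s) ↦ ι y + s e is a linear isomorphism, so it carries the product measure to a Haar
measure, hence to a multiple of Lebesgue measure. Only the finiteness of that multiple matters. -/
theorem exists_lintegral_orthogonal_coordinates_le {d : ℕ} {e : EuclideanSpace ℝ (Fin (d + 1))}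
    (he : ‖e‖ = 1) (ι : EuclideanSpace ℝ (Fin d) →ₗᵢ[ℝ] EuclideanSpace ℝ (Fin (d + 1)))
    (hι : ∀ y, inner ℝ e (ι y) = 0) :
    ∃ c : NNReal, ∀ F : EuclideanSpace ℝ (Fin (d + 1)) → ENNReal, Measurable F →
      ∫⁻ y, ∫⁻ s : ℝ, F (ι y + s • e) = c * ∫⁻ x, F x := by
  let T : (EuclideanSpace ℝ (Fin d) × ℝ) →ₗ[ℝ] EuclideanSpace ℝ (Fin (d + 1)) :=
    ι.toLinearMap.coprod (LinearMap.toSpanSingleton ℝ _ e)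
  have hT : ∀ p, T p = ι p.1 + p.2 • e := fun p => by simp [T]
  have hinj : Function.Injective T := by
    rw [← LinearMap.ker_eq_bot, LinearMap.ker_eq_bot']
    rintro ⟨y, s⟩ h
    rw [hT] at h
    have hs : s = 0 := by
      have h2 := congrArg (inner ℝ e) h
      simpa [inner_add_right, hι, inner_smul_right, real_inner_self_eq_norm_sq, he] using h2
    subst hs
    have hy : ι y = 0 := by simpa using h
    rw [(map_eq_zero_iff ι ι.injective).1 hy]
    rfl
  have hsurj : Function.Surjective T :=
    (LinearMap.injective_iff_surjective_of_finrank_eq_finrank (by simp)).1 hinj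
  let T' := (LinearEquiv.ofBijective T ⟨hinj, hsurj⟩).toContinuousLinearEquiv
  have hT' : ∀ p, T' p = ι p.1 + p.2 • e := fun p => hT p
  let μ : Measure (EuclideanSpace ℝ (Fin (d + 1))) :=
    ((volume : Measure (EuclideanSpace ℝ (Fin d))).prod (volume : Measure ℝ)).map T'
  have : μ.IsAddHaarMeasure := T'.isAddHaarMeasure_map _
  refine ⟨μ.addHaarScalarFactor volume, fun F hF => ?_⟩
  have h1 : ∫⁻ x, F x ∂μ = μ.addHaarScalarFactor volume * ∫⁻ x, F x := by
    conv_lhs => rw [Measure.isAddLeftInvariant_eq_smul μ volume]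
    rw [lintegral_smul_measure]
    rfl
  rw [← h1, lintegral_map hF T'.continuous.measurable,
    lintegral_prod (fun p => F (T' p)) (hF.comp T'.continuous.measurable).aemeasurable]
  simp only [hT']

/-- Fundamental theorem of calculus on the segment from x to x + s e. The gradient is integrated up
to h rather than s so that the last term does not depend on s. -/
theorem enorm_le_enorm_add_lintegral_gradient {E : Type*} [NormedAddCommGroup E]
    [InnerProductSpace ℝ E] [CompleteSpace E] {f : E → ℝ} (hf : ContDiff ℝ ∞ f)
    {e : E} (he : ‖e‖ = 1) (x : E) {s h : ℝ} (hs : 0 ≤ s) (hsh : s ≤ h) :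
    ‖f x‖ₑ ≤ ‖f (x + s • e)‖ₑ + ∫⁻ τ in Set.Icc 0 h, ‖∇ f (x + τ • e)‖ₑ := by
  have hd : ∀ τ : ℝ, HasDerivAt (fun τ : ℝ => f (x + τ • e)) (inner ℝ (∇ f (x + τ • e)) e) τ := by
    intro τ
    have h1 : HasFDerivAt f (fderiv ℝ f (x + τ • e)) (x + τ • e) :=
      (hf.differentiable (by simp) _).hasFDerivAt
    have h2 : HasDerivAt (fun τ : ℝ => x + τ • e) e τ := by
      simpa using ((hasDerivAt_id τ).smul_const e).const_add x
    have h3 := h1.comp_hasDerivAt τ h2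
    simp only [gradient, InnerProductSpace.toDual_symm_apply]
    exact h3
  have hc : ContDiff ℝ 1 (fun τ : ℝ => f (x + τ • e)) :=
    (hf.of_le (by simp)).comp (by fun_prop)
  have h1 := enorm_sub_le_lintegral_deriv_of_contDiffOn_Icc (hc.contDiffOn (s := Set.Icc 0 s)) hs
  have h2 : ∫⁻ τ in Set.Icc 0 s, ‖deriv (fun τ : ℝ => f (x + τ • e)) τ‖ₑ ≤
      ∫⁻ τ in Set.Icc 0 h, ‖∇ f (x + τ • e)‖ₑ := by
    refine lintegral_mono' (Measure.restrict_mono (Set.Icc_subset_Icc_right hsh) le_rfl) ?_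
    intro τ
    simp only [(hd τ).deriv]
    refine enorm_le_iff_norm_le.2 ?_
    simpa [he] using norm_inner_le_norm (𝕜 := ℝ) (∇ f (x + τ • e)) e
  simp only [zero_smul, add_zero] at h1
  calc ‖f x‖ₑ = ‖f (x + s • e) - (f (x + s • e) - f x)‖ₑ := by simp
    _ ≤ ‖f (x + s • e)‖ₑ + ‖f (x + s • e) - f x‖ₑ := enorm_sub_le
    _ ≤ _ := by gcongr; exact h1.trans h2

theorem ContDiff.continuous_gradient {E : Type*} [NormedAddCommGroup E]
    [InnerProductSpace ℝ E] [CompleteSpace E] {f : E → ℝ} (hf : ContDiff ℝ ∞ f) :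
    Continuous (∇ f) := by
  unfold gradient
  exact (InnerProductSpace.toDual ℝ E).symm.continuous.comp (hf.continuous_fderiv (by simp))

/-- Integrate the previous bound over s in [0, h], which replaces the endpoint value by an integral.
-/
theorem enorm_le_lintegral_segment {E : Type*} [NormedAddCommGroup E]
    [InnerProductSpace ℝ E] [CompleteSpace E] {f : E → ℝ} (hf : ContDiff ℝ ∞ f)
    {e : E} (he : ‖e‖ = 1) (x : E) {h : ℝ} :
    ENNReal.ofReal h * ‖f x‖ₑ ≤ (1 + ENNReal.ofReal h) *
      ∫⁻ s in Set.Icc 0 h, (‖f (x + s • e)‖ₑ + ‖∇ f (x + s • e)‖ₑ) := by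
  have hm1 : Measurable (fun s : ℝ => ‖f (x + s • e)‖ₑ) :=
    (hf.continuous.comp (by fun_prop : Continuous fun s : ℝ => x + s • e)).enorm.measurable
  have h1 : ∫⁻ _ in Set.Icc 0 h, ‖f x‖ₑ ≤ ∫⁻ s in Set.Icc 0 h,
      (‖f (x + s • e)‖ₑ + ∫⁻ τ in Set.Icc 0 h, ‖∇ f (x + τ • e)‖ₑ) :=
    setLIntegral_mono' measurableSet_Icc fun s hs =>
      enorm_le_enorm_add_lintegral_gradient hf he x hs.1 hs.2
  rw [lintegral_add_left hm1, setLIntegral_const, setLIntegral_const, Real.volume_Icc, sub_zero,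
    mul_comm] at h1
  refine h1.trans ?_
  rw [lintegral_add_left hm1, add_mul, one_mul, mul_comm (∫⁻ τ in Set.Icc 0 h, _)]
  gcongr
  · exact le_self_add
  · exact le_add_self

/-- Local trace inequality in `W^{1,1}` near a boundary point of a Lipschitz domain. -/
theorem exists_lintegral_nhds_frontier_le {d : ℕ} {Ω : Set (EuclideanSpace ℝ (Fin (d + 1)))}
    (hΩ : IsOpen Ω) (hL : HasLipschitzBoundary Ω) {x₀ : EuclideanSpace ℝ (Fin (d + 1))}
    (hx₀ : x₀ ∈ frontier Ω) :
    ∃ V ∈ 𝓝 x₀, ∃ C : ENNReal, C ≠ ⊤ ∧ ∀ f : EuclideanSpace ℝ (Fin (d + 1)) → ℝ,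
      ContDiff ℝ ∞ f → ∫⁻ x in V ∩ frontier Ω, ‖f x‖ₑ ∂(Measure.euclideanHausdorffMeasure d) ≤
        C * ∫⁻ x in Ω, (‖f x‖ₑ + ‖∇ f x‖ₑ) := by
  obtain ⟨e, K, γ, he, hγ, U, hU, hUΩ⟩ := hL x₀ hx₀
  obtain ⟨r, hr, hrU⟩ := Metric.mem_nhds_iff.1 hU
  obtain ⟨ι, hι, hιs⟩ := exists_linearIsometry_orthogonal he
  obtain ⟨c, hc⟩ := exists_lintegral_orthogonal_coordinates_le he ι hι
  let Γ : EuclideanSpace ℝ (Fin d) → EuclideanSpace ℝ (Fin (d + 1)) := fun y => ι y + γ (ι y) • e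
  have hΓ : LipschitzWith (1 + K) Γ := by
    refine LipschitzWith.add ι.lipschitz ?_
    refine LipschitzWith.of_dist_le_mul fun y z => ?_
    rw [dist_eq_norm, ← sub_smul, norm_smul, he, mul_one, ← dist_eq_norm]
    simpa [ι.dist_map] using hγ.dist_le_mul (ι y) (ι z)
  have hsub : Metric.ball x₀ (r / 2) ∩ frontier Ω ⊆ Set.range Γ := by
    rintro x ⟨hxV, hxΩ⟩
    have hxU : U ∈ 𝓝 x := by
      refine Filter.mem_of_superset (Metric.isOpen_ball.mem_nhds ?_) hrU
      exact Metric.ball_subset_ball (by linarith) hxV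
    have hx1 : x ∉ Ω := by
      rw [frontier, hΩ.interior_eq] at hxΩ
      exact hxΩ.2
    -- Strictly below the graph is an open condition, and it would keep a neighbourhood of x out of
    -- Ω although x lies in the closure of Ω.
    have hx2 : ¬ inner ℝ e x < γ (x - inner ℝ e x • e) := by
      intro hlt
      have hcont : Continuous fun z : EuclideanSpace ℝ (Fin (d + 1)) =>
          γ (z - inner ℝ e z • e) - inner ℝ e z :=
        (hγ.continuous.comp (by fun_prop)).sub (by fun_prop)
      have hev : ∀ᶠ z in 𝓝 x, 0 < γ (z - inner ℝ e z • e) - inner ℝ e z :=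
        hcont.continuousAt.eventually (lt_mem_nhds (sub_pos.2 hlt))
      have hcl : ∃ᶠ z in 𝓝 x, z ∈ Ω := mem_closure_iff_frequently.1 hxΩ.1
      obtain ⟨z, hzΩ, hz, hzU⟩ := (hcl.and_eventually (hev.and hxU)).exists
      have := (hUΩ z hzU).1 hzΩ
      linarith
    have hx3 : ¬ γ (x - inner ℝ e x • e) < inner ℝ e x := fun h =>
      hx1 ((hUΩ x (mem_of_mem_nhds hxU)).2 h)
    have hx4 : γ (x - inner ℝ e x • e) = inner ℝ e x := le_antisymm (not_lt.1 hx2) (not_lt.1 hx3)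
    obtain ⟨y, hy⟩ := hιs x
    refine ⟨y, ?_⟩
    simp only [Γ, hy, hx4]
    simp
  -- The radius is halved so that moving a point of the smaller ball by at most r/2 stays in the
  -- chart.
  have hseg : ∀ x ∈ Metric.ball x₀ (r / 2) ∩ frontier Ω, ∀ s ∈ Set.Ioc 0 (r / 2),
      x + s • e ∈ Ω := by
    intro x hx s hs
    have hxs : x + s • e ∈ U := by
      apply hrU
      have h1 := Metric.mem_ball.1 hx.1
      rw [Metric.mem_ball]
      calc dist (x + s • e) x₀ ≤ dist (x + s • e) x + dist x x₀ := dist_triangle _ _ _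
        _ < r / 2 + r / 2 := by
          refine add_lt_add_of_le_of_lt ?_ h1
          simpa [dist_eq_norm, norm_smul, he, abs_of_pos hs.1] using hs.2
        _ = r := by ring
    refine (hUΩ _ hxs).2 ?_
    obtain ⟨y, rfl⟩ := hsub hx
    have h2 : inner ℝ e (Γ y) = γ (ι y) := by
      simp [Γ, inner_add_right, hι, inner_smul_right, he]
    have h3 : inner ℝ e (Γ y + s • e) = γ (ι y) + s := by
      rw [inner_add_right, h2, inner_smul_right, real_inner_self_eq_norm_sq, he]
      ring
    have h4 : Γ y + s • e - (γ (ι y) + s) • e = ι y := by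
      simp only [Γ]
      module
    rw [h3, h4]
    linarith [hs.1]
  set h : ℝ := r / 2 with hh
  have hh0 : 0 < h := by positivity
  -- The factors come from averaging over a segment of length h, from the Lipschitz constant 1 + K
  -- of the graph map, and from the change of coordinates.
  refine ⟨Metric.ball x₀ h, Metric.ball_mem_nhds _ hh0,
    (ENNReal.ofReal h)⁻¹ * ((1 + ENNReal.ofReal h) * (((1 + K : NNReal) : ENNReal) ^ d * c)),
    ?_, fun f hf => ?_⟩
  · refine ENNReal.mul_ne_top (ENNReal.inv_ne_top.2 (by simpa using hh0)) ?_
    exact ENNReal.mul_ne_top (by simp)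
      (ENNReal.mul_ne_top (ENNReal.pow_ne_top ENNReal.coe_ne_top) ENNReal.coe_ne_top)
  set F : EuclideanSpace ℝ (Fin (d + 1)) → ENNReal := fun x => ‖f x‖ₑ + ‖∇ f x‖ₑ with hF
  have hFm : Measurable F :=
    (hf.continuous.enorm.add hf.continuous_gradient.enorm).measurable
  have hGm : Measurable (Ω.indicator F) := hFm.indicator hΩ.measurableSet
  set W := Metric.ball x₀ h ∩ frontier Ω with hW
  have hWm : MeasurableSet W := Metric.isOpen_ball.measurableSet.inter isClosed_frontier.measurableSet
  have hpt : ∀ x ∈ W, ENNReal.ofReal h * ‖f x‖ₑ ≤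
      (1 + ENNReal.ofReal h) * ∫⁻ s : ℝ, Ω.indicator F (x + s • e) := by
    intro x hx
    refine (enorm_le_lintegral_segment hf he x).trans ?_
    refine mul_le_mul_right ?_ _
    -- At s = 0 the point lies on ∂Ω, outside the open set Ω, so this endpoint is dropped.
    rw [setLIntegral_congr Ioc_ae_eq_Icc.symm]
    refine le_trans (setLIntegral_mono' measurableSet_Ioc fun s hs => ?_) (setLIntegral_le_lintegral _ _)
    rw [Set.indicator_of_mem (hseg x hx s hs)]
  have hIm : Measurable fun x => ∫⁻ s : ℝ, Ω.indicator F (x + s • e) := by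
    refine Measurable.lintegral_prod_right' (f := fun p : EuclideanSpace ℝ (Fin (d + 1)) × ℝ =>
      Ω.indicator F (p.1 + p.2 • e)) ?_
    exact hGm.comp (by fun_prop)
  have hmain : ENNReal.ofReal h * ∫⁻ x in W, ‖f x‖ₑ ∂(Measure.euclideanHausdorffMeasure d) ≤
      (1 + ENNReal.ofReal h) * (((1 + K : NNReal) : ENNReal) ^ d * c) * ∫⁻ x in Ω, F x := by
    rw [← lintegral_const_mul _ hf.continuous.enorm.measurable]
    calc ∫⁻ x in W, ENNReal.ofReal h * ‖f x‖ₑ ∂(Measure.euclideanHausdorffMeasure d)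
        ≤ ∫⁻ x in W, (1 + ENNReal.ofReal h) * (∫⁻ s : ℝ, Ω.indicator F (x + s • e))
            ∂(Measure.euclideanHausdorffMeasure d) := setLIntegral_mono' hWm hpt
      _ ≤ ∫⁻ x, (1 + ENNReal.ofReal h) * (∫⁻ s : ℝ, Ω.indicator F (x + s • e))
            ∂((((1 + K : NNReal) : ENNReal) ^ d) •
              (volume : Measure (EuclideanSpace ℝ (Fin d))).map Γ) :=
          lintegral_mono' (restrict_range_euclideanHausdorffMeasure_le hΓ hsub) le_rfl
      _ = ((1 + K : NNReal) : ENNReal) ^ d * ((1 + ENNReal.ofReal h) *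
            ∫⁻ y, ∫⁻ s : ℝ, Ω.indicator F (Γ y + s • e)) := by
          rw [lintegral_smul_measure, lintegral_const_mul _ hIm,
            lintegral_map hIm hΓ.continuous.measurable, smul_eq_mul]
      _ = ((1 + K : NNReal) : ENNReal) ^ d * ((1 + ENNReal.ofReal h) *
            ∫⁻ y, ∫⁻ s : ℝ, Ω.indicator F (ι y + s • e)) := by
          congr 2
          refine lintegral_congr fun y => ?_
          -- Translating s by γ(ι y) straightens the graph, so no differentiability of γ is needed.
          rw [← lintegral_add_left_eq_self (fun s : ℝ => Ω.indicator F (ι y + s • e)) (γ (ι y))]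
          refine lintegral_congr fun s => ?_
          congr 1
          simp only [Γ]
          module
      _ = _ := by
          rw [hc _ hGm, lintegral_indicator hΩ.measurableSet]
          ring
  have h0 : ENNReal.ofReal h ≠ 0 := by simpa using hh0
  calc ∫⁻ x in W, ‖f x‖ₑ ∂(Measure.euclideanHausdorffMeasure d)
      = (ENNReal.ofReal h)⁻¹ * (ENNReal.ofReal h *
          ∫⁻ x in W, ‖f x‖ₑ ∂(Measure.euclideanHausdorffMeasure d)) := by
        rw [← mul_assoc, ENNReal.inv_mul_cancel h0 ENNReal.ofReal_ne_top, one_mul]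
    _ ≤ _ := by
        rw [mul_assoc]
        gcongr

/-- Trace inequality in `W^{1,1}` on a bounded Lipschitz domain. -/
theorem exists_lintegral_surfaceMeasure_le {n : ℕ} (hn : 1 ≤ n)
    {Ω : Set (EuclideanSpace ℝ (Fin n))} (hΩ : IsBoundedLipschitzDomain Ω) :
    ∃ C : ENNReal, C ≠ ⊤ ∧ ∀ f : EuclideanSpace ℝ (Fin n) → ℝ, ContDiff ℝ ∞ f →
      ∫⁻ x, ‖f x‖ₑ ∂(surfaceMeasure Ω) ≤ C * ∫⁻ x in Ω, (‖f x‖ₑ + ‖∇ f x‖ₑ) := by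
  -- This turns the truncated subtraction `n - 1` in `surfaceMeasure` into `d`.
  obtain ⟨d, rfl⟩ : ∃ d, n = d + 1 := ⟨n - 1, by omega⟩
  have hcomp : IsCompact (frontier Ω) :=
    Metric.isCompact_of_isClosed_isBounded isClosed_frontier
      (hΩ.isBounded.closure.subset frontier_subset_closure)
  choose! V hV C hC hle using fun x (hx : x ∈ frontier Ω) =>
    exists_lintegral_nhds_frontier_le hΩ.isOpen hΩ.lipschitz hx
  obtain ⟨t, ht, hcov⟩ := hcomp.elim_nhds_subcover V hV
  refine ⟨∑ x ∈ t, C x, by simpa using fun x hx => hC x (ht x hx), fun f hf => ?_⟩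
  rw [Finset.sum_mul]
  have h1 : frontier Ω ⊆ ⋃ i : t, (V i ∩ frontier Ω) := fun x hx => by
    have := hcov hx
    simp only [Set.mem_iUnion] at this ⊢
    obtain ⟨i, hi, hxi⟩ := this
    exact ⟨⟨i, hi⟩, hxi, hx⟩
  calc ∫⁻ x, ‖f x‖ₑ ∂(surfaceMeasure Ω)
      ≤ ∫⁻ x in ⋃ i : t, (V i ∩ frontier Ω), ‖f x‖ₑ ∂(Measure.euclideanHausdorffMeasure d) :=
        lintegral_mono' (Measure.restrict_mono h1 le_rfl) le_rfl
    _ ≤ ∑' i : t, ∫⁻ x in V i ∩ frontier Ω, ‖f x‖ₑ ∂(Measure.euclideanHausdorffMeasure d) :=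
        lintegral_iUnion_le _ _
    _ = ∑ i ∈ t, ∫⁻ x in V i ∩ frontier Ω, ‖f x‖ₑ ∂(Measure.euclideanHausdorffMeasure d) :=
        Finset.tsum_subtype t fun i =>
          ∫⁻ x in V i ∩ frontier Ω, ‖f x‖ₑ ∂(Measure.euclideanHausdorffMeasure d)
    _ ≤ _ := Finset.sum_le_sum fun i hi => hle i (ht i hi) f hf

theorem IsBoundedLipschitzDomain.isFiniteMeasure_restrict {n : ℕ}
    {Ω : Set (EuclideanSpace ℝ (Fin n))} (hΩ : IsBoundedLipschitzDomain Ω) :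
    IsFiniteMeasure (volume.restrict Ω) :=
  ⟨by rw [Measure.restrict_apply_univ]; exact hΩ.isBounded.measure_lt_top⟩

/-- This is the trace inequality for the constant function 1. -/
theorem IsBoundedLipschitzDomain.isFiniteMeasure_surfaceMeasure {n : ℕ} (hn : 1 ≤ n)
    {Ω : Set (EuclideanSpace ℝ (Fin n))} (hΩ : IsBoundedLipschitzDomain Ω) :
    IsFiniteMeasure (surfaceMeasure Ω) := by
  obtain ⟨C, hC, h⟩ := exists_lintegral_surfaceMeasure_le hn hΩ
  have h1 := h (fun _ => 1) contDiff_const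
  have hg : ∀ x : EuclideanSpace ℝ (Fin n), ∇ (fun _ : EuclideanSpace ℝ (Fin n) => (1 : ℝ)) x = 0 :=
    fun x => by simp [gradient]
  simp only [hg, enorm_one, enorm_zero, add_zero, lintegral_const, one_mul,
    Measure.restrict_apply_univ] at h1
  exact ⟨h1.trans_lt (ENNReal.mul_lt_top hC.lt_top hΩ.isBounded.measure_lt_top)⟩

/-! ### Passing to the limit in L² -/

section LpConvergence

variable {α F : Type*} [MeasurableSpace α] {μ : Measure α} [NormedAddCommGroup F]

theorem tendsto_integral_inner_of_tendsto_eLpNorm [InnerProductSpace ℝ F]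
    {f h : ℕ → α → F} {u v : α → F}
    (hf : ∀ k, MemLp (f k) 2 μ) (hu : MemLp u 2 μ) (hh : ∀ k, MemLp (h k) 2 μ) (hv : MemLp v 2 μ)
    (hfu : Tendsto (fun k => eLpNorm (fun x => f k x - u x) 2 μ) atTop (𝓝 0))
    (hhv : Tendsto (fun k => eLpNorm (fun x => h k x - v x) 2 μ) atTop (𝓝 0)) :
    Tendsto (fun k => ∫ x, inner ℝ (f k x) (h k x) ∂μ) atTop (𝓝 (∫ x, inner ℝ (u x) (v x) ∂μ)) := by
  have key : ∀ {a b : α → F} (ha : MemLp a 2 μ) (hb : MemLp b 2 μ),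
      inner ℝ (ha.toLp a) (hb.toLp b) = ∫ x, inner ℝ (a x) (b x) ∂μ := by
    intro a b ha hb
    rw [L2.inner_def]
    refine integral_congr_ae ?_
    filter_upwards [ha.coeFn_toLp, hb.coeFn_toLp] with x hx hy
    rw [hx, hy]
  have h1 := (Lp.tendsto_Lp_iff_tendsto_eLpNorm'' f hf u hu).2 hfu
  have h2 := (Lp.tendsto_Lp_iff_tendsto_eLpNorm'' h hh v hv).2 hhv
  have h3 := h1.inner (𝕜 := ℝ) h2
  simpa only [key] using h3

theorem tendsto_integral_mul_of_tendsto_eLpNorm {f h : ℕ → α → ℝ} {u v : α → ℝ}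
    (hf : ∀ k, MemLp (f k) 2 μ) (hu : MemLp u 2 μ) (hh : ∀ k, MemLp (h k) 2 μ) (hv : MemLp v 2 μ)
    (hfu : Tendsto (fun k => eLpNorm (fun x => f k x - u x) 2 μ) atTop (𝓝 0))
    (hhv : Tendsto (fun k => eLpNorm (fun x => h k x - v x) 2 μ) atTop (𝓝 0)) :
    Tendsto (fun k => ∫ x, f k x * h k x ∂μ) atTop (𝓝 (∫ x, u x * v x ∂μ)) := by
  have := tendsto_integral_inner_of_tendsto_eLpNorm hh hv hf hu hhv hfu
  simpa using this

theorem tendsto_eLpNorm_two_of_dominated {h : ℕ → α → F} {b : α → ℝ}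
    (hm : ∀ k, AEStronglyMeasurable (h k) μ) (hb : MemLp b 2 μ)
    (hle : ∀ k, ∀ᵐ x ∂μ, ‖h k x‖ ≤ b x)
    (hlim : ∀ᵐ x ∂μ, Tendsto (fun k => h k x) atTop (𝓝 0)) :
    Tendsto (fun k => eLpNorm (h k) 2 μ) atTop (𝓝 0) := by
  have h1 : Tendsto (fun k => ∫⁻ x, ‖h k x‖ₑ ^ (2 : ℝ) ∂μ) atTop (𝓝 (∫⁻ _, 0 ∂μ)) := by
    refine tendsto_lintegral_of_dominated_convergence' (fun x => ‖b x‖ₑ ^ (2 : ℝ))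
      (fun k => (hm k).enorm.pow_const _) (fun k => ?_) ?_ ?_
    · filter_upwards [hle k] with x hx
      refine ENNReal.rpow_le_rpow (enorm_le_iff_norm_le.2 (hx.trans (le_abs_self _))) (by norm_num)
    · have := lintegral_rpow_enorm_lt_top_of_eLpNorm_lt_top (by norm_num) (by norm_num)
        hb.eLpNorm_lt_top
      simpa using this.ne
    · filter_upwards [hlim] with x hx
      have h2 : Tendsto (fun k => ‖h k x‖ₑ) atTop (𝓝 0) := by
        simpa using hx.enorm
      simpa using h2.ennrpow_const (2 : ℝ)
  rw [lintegral_zero] at h1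
  have h3 := h1.ennrpow_const (1 / 2 : ℝ)
  simp only [eLpNorm_eq_lintegral_rpow_enorm_toReal (p := 2) (by norm_num) (by norm_num)]
  simpa using h3

/-- Split the difference as aₖ(hₖ - v) + (aₖ - a')v: the first term is controlled by the uniform
bound on aₖ, the second by dominated convergence. -/
theorem tendsto_eLpNorm_smul_of_tendsto_ae [NormedSpace ℝ F] {a : ℕ → α → ℝ} {a' : α → ℝ}
    {h : ℕ → α → F} {v : α → F} {M : ℝ}
    (ha : ∀ k, AEStronglyMeasurable (a k) μ) (ha' : AEStronglyMeasurable a' μ)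
    (haM : ∀ k, ∀ᵐ x ∂μ, |a k x| ≤ M) (ha'M : ∀ᵐ x ∂μ, |a' x| ≤ M)
    (hlim : ∀ᵐ x ∂μ, Tendsto (fun k => a k x) atTop (𝓝 (a' x)))
    (hh : ∀ k, AEStronglyMeasurable (h k) μ) (hv : MemLp v 2 μ)
    (hhv : Tendsto (fun k => eLpNorm (fun x => h k x - v x) 2 μ) atTop (𝓝 0)) :
    Tendsto (fun k => eLpNorm (fun x => a k x • h k x - a' x • v x) 2 μ) atTop (𝓝 0) := by
  have h1 : Tendsto (fun k => eLpNorm (fun x => a k x • (h k x - v x)) 2 μ) atTop (𝓝 0) := by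
    refine tendsto_of_tendsto_of_tendsto_of_le_of_le tendsto_const_nhds
      (h := fun k => ENNReal.ofReal M * eLpNorm (fun x => h k x - v x) 2 μ) ?_
      (fun _ => zero_le) fun k => ?_
    · simpa using ENNReal.Tendsto.const_mul hhv (Or.inr ENNReal.ofReal_ne_top)
    · refine eLpNorm_le_mul_eLpNorm_of_ae_le_mul ?_ 2
      filter_upwards [haM k] with x hx
      rw [norm_smul]
      gcongr
      exact hx
  have h2 : Tendsto (fun k => eLpNorm (fun x => (a k x - a' x) • v x) 2 μ) atTop (𝓝 0) := by
    refine tendsto_eLpNorm_two_of_dominated (b := fun x => (2 * M) * ‖v x‖)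
      (fun k => ((ha k).sub ha').smul hv.1) (hv.norm.const_mul (2 * M)) (fun k => ?_) ?_
    · filter_upwards [haM k, ha'M] with x hx hx'
      rw [norm_smul]
      gcongr
      calc ‖a k x - a' x‖ ≤ ‖a k x‖ + ‖a' x‖ := norm_sub_le _ _
        _ ≤ 2 * M := by
          rw [Real.norm_eq_abs, Real.norm_eq_abs]
          linarith
    · filter_upwards [hlim] with x hx
      have h3 : Tendsto (fun k => a k x - a' x) atTop (𝓝 0) := by
        simpa using hx.sub_const (a' x)
      simpa using h3.smul_const (v x)
  refine tendsto_of_tendsto_of_tendsto_of_le_of_le tendsto_const_nhds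
    (h := fun k => eLpNorm (fun x => a k x • (h k x - v x)) 2 μ +
      eLpNorm (fun x => (a k x - a' x) • v x) 2 μ) ?_ (fun _ => zero_le) fun k => ?_
  · simpa using h1.add h2
  · have h4 : (fun x => a k x • h k x - a' x • v x) =
        (fun x => a k x • (h k x - v x)) + fun x => (a k x - a' x) • v x := by
      ext x
      simp only [Pi.add_apply]
      module
    rw [h4]
    exact eLpNorm_add_le ((ha k).smul ((hh k).sub hv.1)) (((ha k).sub ha').smul hv.1) (by norm_num)

theorem tendsto_eLpNorm_one_of_tendsto_eLpNorm_two [IsFiniteMeasure μ] {h : ℕ → α → F}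
    (hm : ∀ k, AEStronglyMeasurable (h k) μ)
    (hlim : Tendsto (fun k => eLpNorm (h k) 2 μ) atTop (𝓝 0)) :
    Tendsto (fun k => eLpNorm (h k) 1 μ) atTop (𝓝 0) := by
  refine tendsto_of_tendsto_of_tendsto_of_le_of_le tendsto_const_nhds
    (h := fun k => eLpNorm (h k) 2 μ * μ Set.univ ^ (1 / (1 : ENNReal).toReal -
      1 / (2 : ENNReal).toReal)) ?_ (fun _ => zero_le) fun k =>
        eLpNorm_le_eLpNorm_mul_rpow_measure_univ (by norm_num) (hm k)
  have hne : μ Set.univ ^ (1 / (1 : ENNReal).toReal - 1 / (2 : ENNReal).toReal) ≠ ⊤ :=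
    ENNReal.rpow_ne_top_of_nonneg (by norm_num) (measure_ne_top _ _)
  simpa using ENNReal.Tendsto.mul_const hlim (Or.inr hne)

end LpConvergence

/-! ### Gradient rules for smooth functions -/

section Gradient

variable {E : Type*} [NormedAddCommGroup E] [InnerProductSpace ℝ E] [CompleteSpace E]

theorem gradient_comp {G : ℝ → ℝ} {f : E → ℝ} (hG : ContDiff ℝ ∞ G) (hf : ContDiff ℝ ∞ f) (x : E) :
    ∇ (fun y => G (f y)) x = deriv G (f x) • ∇ f x := by
  have h1 : HasDerivAt G (deriv G (f x)) (f x) :=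
    (hG.differentiable (by simp) _).hasDerivAt
  have h2 : HasFDerivAt f (fderiv ℝ f x) x := (hf.differentiable (by simp) x).hasFDerivAt
  have h3 := (h1.comp_hasFDerivAt x h2).fderiv
  simp only [gradient]
  rw [← map_smul, ← h3]
  rfl

theorem gradient_mul {f h : E → ℝ} (hf : ContDiff ℝ ∞ f) (hh : ContDiff ℝ ∞ h) (x : E) :
    ∇ (fun y => f y * h y) x = f x • ∇ h x + h x • ∇ f x := by
  simp only [gradient]
  rw [fderiv_fun_mul (hf.differentiable (by simp) x) (hh.differentiable (by simp) x), map_add,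
    map_smul, map_smul]

theorem gradient_sub {f h : E → ℝ} (hf : ContDiff ℝ ∞ f) (hh : ContDiff ℝ ∞ h) (x : E) :
    ∇ (fun y => f y - h y) x = ∇ f x - ∇ h x := by
  simp only [gradient]
  rw [fderiv_fun_sub (hf.differentiable (by simp) x) (hh.differentiable (by simp) x), map_sub]

end Gradient

/-! ### Sobolev functions with traces: uniqueness, products, chain rule -/

section SobolevTrace

variable {n : ℕ} {Ω : Set (EuclideanSpace ℝ (Fin n))}

/-- `u ∈ H¹(Ω)` has weak gradient `g` and trace `t`, in the sense that there are functions smooth up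
to the boundary which converge to `u` in `H¹(Ω)` and whose boundary values converge to `t`. -/
structure HasSobolevTrace (Ω : Set (EuclideanSpace ℝ (Fin n)))
    (u : EuclideanSpace ℝ (Fin n) → ℝ) (g : EuclideanSpace ℝ (Fin n) → EuclideanSpace ℝ (Fin n))
    (t : EuclideanSpace ℝ (Fin n) → ℝ) : Prop where
  memLp : MemLp u 2 (volume.restrict Ω)
  memLp_gradient : MemLp g 2 (volume.restrict Ω)
  memLp_trace : MemLp t 2 (surfaceMeasure Ω)
  exists_approx : ∃ f : ℕ → EuclideanSpace ℝ (Fin n) → ℝ,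
    (∀ k, ContDiff ℝ ∞ (f k)) ∧
    Tendsto (fun k => eLpNorm (fun x => f k x - u x) 2 (volume.restrict Ω)) atTop (𝓝 0) ∧
    Tendsto (fun k => eLpNorm (fun x => ∇ (f k) x - g x) 2 (volume.restrict Ω)) atTop (𝓝 0) ∧
    Tendsto (fun k => eLpNorm (fun x => f k x - t x) 2 (surfaceMeasure Ω)) atTop (𝓝 0)

theorem exists_bound_closure (hΩ : Bornology.IsBounded Ω) {F : Type*} [NormedAddCommGroup F]
    {h : EuclideanSpace ℝ (Fin n) → F} (hh : Continuous h) :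
    ∃ C, ∀ x ∈ closure Ω, ‖h x‖ ≤ C :=
  (Metric.isCompact_of_isClosed_isBounded isClosed_closure hΩ.closure).exists_bound_of_continuousOn
    hh.continuousOn

theorem ae_restrict_mem_closure (hΩ : IsOpen Ω) : ∀ᵐ x ∂(volume.restrict Ω), x ∈ closure Ω :=
  (ae_restrict_mem hΩ.measurableSet).mono fun _ hx => subset_closure hx

theorem ae_surfaceMeasure_mem_closure : ∀ᵐ x ∂(surfaceMeasure Ω), x ∈ closure Ω :=
  (ae_restrict_mem isClosed_frontier.measurableSet).mono fun _ hx => frontier_subset_closure hx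

theorem Continuous.memLp_of_ae_mem_closure (hΩ : Bornology.IsBounded Ω) {F : Type*}
    [NormedAddCommGroup F] {h : EuclideanSpace ℝ (Fin n) → F} (hh : Continuous h)
    {μ : Measure (EuclideanSpace ℝ (Fin n))} [IsFiniteMeasure μ] (hμ : ∀ᵐ x ∂μ, x ∈ closure Ω)
    (p : ENNReal) : MemLp h p μ := by
  obtain ⟨C, hC⟩ := exists_bound_closure hΩ hh
  exact MemLp.of_bound (hh.aestronglyMeasurable) C (hμ.mono fun x hx => hC x hx)

theorem IsBoundedLipschitzDomain.memLp_of_continuous (hΩ : IsBoundedLipschitzDomain Ω)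
    {F : Type*} [NormedAddCommGroup F] {h : EuclideanSpace ℝ (Fin n) → F} (hh : Continuous h)
    (p : ENNReal) : MemLp h p (volume.restrict Ω) := by
  have := hΩ.isFiniteMeasure_restrict
  exact hh.memLp_of_ae_mem_closure hΩ.isBounded (ae_restrict_mem_closure hΩ.isOpen) p

theorem IsBoundedLipschitzDomain.memLp_surfaceMeasure_of_continuous (hn : 1 ≤ n)
    (hΩ : IsBoundedLipschitzDomain Ω)
    {F : Type*} [NormedAddCommGroup F] {h : EuclideanSpace ℝ (Fin n) → F} (hh : Continuous h)
    (p : ENNReal) : MemLp h p (surfaceMeasure Ω) := by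
  have := hΩ.isFiniteMeasure_surfaceMeasure hn
  exact hh.memLp_of_ae_mem_closure hΩ.isBounded ae_surfaceMeasure_mem_closure p

/-- Both integrands vanish off Ω with η, so integration by parts on the whole space applies and no
boundary term appears. -/
theorem integral_mul_inner_gradient {f η : EuclideanSpace ℝ (Fin n) → ℝ} (hf : ContDiff ℝ ∞ f)
    (hη : ContDiff ℝ ∞ η) (hc : HasCompactSupport η) (hs : tsupport η ⊆ Ω)
    (w : EuclideanSpace ℝ (Fin n)) :
    ∫ x in Ω, f x * inner ℝ (∇ η x) w = -∫ x in Ω, inner ℝ (∇ f x) w * η x := by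
  have hη0 : ∀ x, x ∉ Ω → η x = 0 := fun x hx =>
    image_eq_zero_of_notMem_tsupport fun h => hx (hs h)
  have hη1 : ∀ x, x ∉ Ω → fderiv ℝ η x = 0 := fun x hx =>
    image_eq_zero_of_notMem_tsupport fun h => hx (hs (tsupport_fderiv_subset ℝ h))
  rw [setIntegral_eq_integral_of_forall_compl_eq_zero fun x hx => by
      simp [gradient, hη1 x hx],
    setIntegral_eq_integral_of_forall_compl_eq_zero fun x hx => by simp [hη0 x hx]]
  simp only [gradient, InnerProductSpace.toDual_symm_apply]
  have hcf := hf.continuous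
  have hcη := hη.continuous
  have hcf' := hf.continuous_fderiv (by simp)
  have hcη' := hη.continuous_fderiv (by simp)
  refine integral_mul_fderiv_eq_neg_fderiv_mul_of_integrable ?_ ?_ ?_
    (fun x _ => hf.differentiable (by simp) x) (fun x _ => hη.differentiable (by simp) x)
  · exact Continuous.integrable_of_hasCompactSupport (by fun_prop) hc.mul_left
  · exact Continuous.integrable_of_hasCompactSupport (by fun_prop)
      (hc.fderiv_apply (𝕜 := ℝ) w).mul_left
  · exact Continuous.integrable_of_hasCompactSupport (by fun_prop) hc.mul_left

theorem HasSobolevTrace.hasH1Gradient (hΩ : IsBoundedLipschitzDomain Ω)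
    {u t : EuclideanSpace ℝ (Fin n) → ℝ} {g : EuclideanSpace ℝ (Fin n) → EuclideanSpace ℝ (Fin n)}
    (h : HasSobolevTrace Ω u g t) : HasH1Gradient Ω u g where
  memLp := h.memLp
  memLp_gradient := h.memLp_gradient
  integral_eq := by
    intro η hη hc hs w
    obtain ⟨f, hf, hfu, hfg, -⟩ := h.exists_approx
    have hη1 : Continuous fun x => inner ℝ (∇ η x) w :=
      hη.continuous_gradient.inner continuous_const
    have hη2 : Continuous fun x => η x • w := hη.continuous.smul continuous_const
    have h1 := tendsto_integral_mul_of_tendsto_eLpNorm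
      (fun k => hΩ.memLp_of_continuous (hf k).continuous 2) h.memLp
      (fun _ => hΩ.memLp_of_continuous hη1 2) (hΩ.memLp_of_continuous hη1 2) hfu
      (by simp)
    have h2 := tendsto_integral_inner_of_tendsto_eLpNorm
      (fun k => hΩ.memLp_of_continuous (hf k).continuous_gradient 2) h.memLp_gradient
      (fun _ => hΩ.memLp_of_continuous hη2 2) (hΩ.memLp_of_continuous hη2 2) hfg
      (by simp)
    simp only [inner_smul_right, mul_comm (η _)] at h2
    refine tendsto_nhds_unique h1 (h2.neg.congr fun k => ?_)
    exact (integral_mul_inner_gradient (hf k) hη hc hs w).symm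

theorem HasSobolevTrace.isTrace (hΩ : IsBoundedLipschitzDomain Ω)
    {u t : EuclideanSpace ℝ (Fin n) → ℝ} {g : EuclideanSpace ℝ (Fin n) → EuclideanSpace ℝ (Fin n)}
    (h : HasSobolevTrace Ω u g t) : IsTrace Ω u t :=
  ⟨h.memLp_trace, g, h.hasH1Gradient hΩ, h.exists_approx⟩

/-- The difference integrates to zero against every test function, so the fundamental lemma of the
calculus of variations applies. -/
theorem HasH1Gradient.ae_eq (hΩ : IsBoundedLipschitzDomain Ω) {u : EuclideanSpace ℝ (Fin n) → ℝ}
    {g g' : EuclideanSpace ℝ (Fin n) → EuclideanSpace ℝ (Fin n)}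
    (h : HasH1Gradient Ω u g) (h' : HasH1Gradient Ω u g') :
    g =ᵐ[volume.restrict Ω] g' := by
  have hloc : ∀ {v : EuclideanSpace ℝ (Fin n) → EuclideanSpace ℝ (Fin n)},
      MemLp v 2 (volume.restrict Ω) → ∀ {η : EuclideanSpace ℝ (Fin n) → ℝ}, ContDiff ℝ ∞ η →
      HasCompactSupport η → Integrable (fun x => η x • v x) (volume.restrict Ω) := by
    intro v hv η hη hc
    have h1 : MemLp η 2 (volume.restrict Ω) := hη.continuous.memLp_of_hasCompactSupport hc
    exact memLp_one_iff_integrable.1 (MemLp.smul (p := 2) (q := 2) hv h1)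
  have := hΩ.isFiniteMeasure_restrict
  have hint : IntegrableOn (fun x => g x - g' x) Ω :=
    (h.memLp_gradient.sub h'.memLp_gradient).integrable (by norm_num)
  have hmain := hΩ.isOpen.ae_eq_zero_of_integral_contDiff_smul_eq_zero
    hint.locallyIntegrableOn fun η hη hc hs => ?_
  · filter_upwards [ae_restrict_of_ae hmain, ae_restrict_mem hΩ.isOpen.measurableSet] with x hx hxΩ
    exact sub_eq_zero.1 (hx hxΩ)
  · rw [← setIntegral_eq_integral_of_forall_compl_eq_zero (s := Ω) fun x hx => by
      simp [image_eq_zero_of_notMem_tsupport fun h => hx (hs h)]]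
    refine ext_inner_right ℝ fun w => ?_
    simp only [smul_sub]
    have hi := hloc h.memLp_gradient hη hc
    have hi' := hloc h'.memLp_gradient hη hc
    rw [integral_sub hi hi', inner_sub_left, inner_zero_left, sub_eq_zero, real_inner_comm,
      ← integral_inner hi, real_inner_comm, ← integral_inner hi']
    have h1 := (h.integral_eq η hη hc hs w).symm.trans (h'.integral_eq η hη hc hs w)
    rw [neg_inj] at h1
    simpa [inner_smul_right, real_inner_comm, mul_comm] using h1

/-- `IsTrace` hides its own weak gradient in an existential; uniqueness of weak gradients lets it be
exchanged for the given one. -/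
theorem IsTrace.hasSobolevTrace (hΩ : IsBoundedLipschitzDomain Ω)
    {u t : EuclideanSpace ℝ (Fin n) → ℝ} {g : EuclideanSpace ℝ (Fin n) → EuclideanSpace ℝ (Fin n)}
    (ht : IsTrace Ω u t) (hg : HasH1Gradient Ω u g) : HasSobolevTrace Ω u g t := by
  obtain ⟨htm, g', hg', f, hf, hfu, hfg, hft⟩ := ht
  refine ⟨hg.memLp, hg.memLp_gradient, htm, f, hf, hfu, ?_, hft⟩
  refine hfg.congr fun k => eLpNorm_congr_ae ?_
  filter_upwards [hg'.ae_eq hΩ hg] with x hx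
  rw [hx]

theorem HasSobolevTrace.sub (hn : 1 ≤ n) (hΩ : IsBoundedLipschitzDomain Ω)
    {u u' t t' : EuclideanSpace ℝ (Fin n) → ℝ}
    {g g' : EuclideanSpace ℝ (Fin n) → EuclideanSpace ℝ (Fin n)}
    (h : HasSobolevTrace Ω u g t) (h' : HasSobolevTrace Ω u' g' t') :
    HasSobolevTrace Ω (fun x => u x - u' x) (fun x => g x - g' x) (fun x => t x - t' x) := by
  obtain ⟨f, hf, hfu, hfg, hft⟩ := h.exists_approx
  obtain ⟨f', hf', hfu', hfg', hft'⟩ := h'.exists_approx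
  have key : ∀ {F : Type} [NormedAddCommGroup F] {μ : Measure (EuclideanSpace ℝ (Fin n))}
      {a a' : ℕ → EuclideanSpace ℝ (Fin n) → F} {v v' : EuclideanSpace ℝ (Fin n) → F},
      (∀ k, MemLp (a k) 2 μ) → (∀ k, MemLp (a' k) 2 μ) → MemLp v 2 μ → MemLp v' 2 μ →
      Tendsto (fun k => eLpNorm (fun x => a k x - v x) 2 μ) atTop (𝓝 0) →
      Tendsto (fun k => eLpNorm (fun x => a' k x - v' x) 2 μ) atTop (𝓝 0) →
      Tendsto (fun k => eLpNorm (fun x => a k x - a' k x - (v x - v' x)) 2 μ) atTop (𝓝 0) := by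
    intro F _ μ a a' v v' ha ha' hv hv' hav hav'
    refine tendsto_of_tendsto_of_tendsto_of_le_of_le tendsto_const_nhds
      (by simpa using hav.add hav') (fun _ => zero_le) fun k => ?_
    have h4 : (fun x => a k x - a' k x - (v x - v' x)) =
        (fun x => a k x - v x) - fun x => a' k x - v' x := by
      ext x
      simp only [Pi.sub_apply]
      abel
    rw [h4]
    exact eLpNorm_sub_le ((ha k).sub hv).1 ((ha' k).sub hv').1 (by norm_num)
  refine ⟨h.memLp.sub h'.memLp, h.memLp_gradient.sub h'.memLp_gradient,
    h.memLp_trace.sub h'.memLp_trace, fun k x => f k x - f' k x, fun k => (hf k).sub (hf' k),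
    ?_, ?_, ?_⟩
  · exact key (fun k => hΩ.memLp_of_continuous (hf k).continuous 2)
      (fun k => hΩ.memLp_of_continuous (hf' k).continuous 2) h.memLp h'.memLp hfu hfu'
  · simp only [gradient_sub (hf _) (hf' _)]
    exact key (fun k => hΩ.memLp_of_continuous (hf k).continuous_gradient 2)
      (fun k => hΩ.memLp_of_continuous (hf' k).continuous_gradient 2) h.memLp_gradient
      h'.memLp_gradient hfg hfg'
  · exact key (fun k => hΩ.memLp_surfaceMeasure_of_continuous hn (hf k).continuous 2)
      (fun k => hΩ.memLp_surfaceMeasure_of_continuous hn (hf' k).continuous 2) h.memLp_trace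
      h'.memLp_trace hft hft'

/-- The trace inequality `‖t‖_{L¹(∂Ω)} ≤ C (‖u‖_{L¹(Ω)} + ‖∇u‖_{L¹(Ω)})`. -/
theorem exists_eLpNorm_trace_le (hn : 1 ≤ n) (hΩ : IsBoundedLipschitzDomain Ω) :
    ∃ C : ENNReal, C ≠ ⊤ ∧ ∀ (u : EuclideanSpace ℝ (Fin n) → ℝ)
      (g : EuclideanSpace ℝ (Fin n) → EuclideanSpace ℝ (Fin n)) (t : EuclideanSpace ℝ (Fin n) → ℝ),
      HasSobolevTrace Ω u g t → eLpNorm t 1 (surfaceMeasure Ω) ≤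
        C * (eLpNorm u 1 (volume.restrict Ω) + eLpNorm g 1 (volume.restrict Ω)) := by
  have := hΩ.isFiniteMeasure_restrict
  have := hΩ.isFiniteMeasure_surfaceMeasure hn
  obtain ⟨C, hC, hle⟩ := exists_lintegral_surfaceMeasure_le hn hΩ
  refine ⟨C, hC, fun u g t h => ?_⟩
  obtain ⟨f, hf, hfu, hfg, hft⟩ := h.exists_approx
  have hfm := fun k => hΩ.memLp_of_continuous (hf k).continuous 2
  have hfgm := fun k => hΩ.memLp_of_continuous (hf k).continuous_gradient 2
  have hftm := fun k => hΩ.memLp_surfaceMeasure_of_continuous hn (hf k).continuous 2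
  have hfu1 := tendsto_eLpNorm_one_of_tendsto_eLpNorm_two (fun k => ((hfm k).sub h.memLp).1) hfu
  have hfg1 := tendsto_eLpNorm_one_of_tendsto_eLpNorm_two
    (fun k => ((hfgm k).sub h.memLp_gradient).1) hfg
  have hft1 := tendsto_eLpNorm_one_of_tendsto_eLpNorm_two
    (fun k => ((hftm k).sub h.memLp_trace).1) hft
  have htri : ∀ {F : Type} [NormedAddCommGroup F] {μ : Measure (EuclideanSpace ℝ (Fin n))}
      {a v : EuclideanSpace ℝ (Fin n) → F}, AEStronglyMeasurable a μ → AEStronglyMeasurable v μ →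
      eLpNorm a 1 μ ≤ eLpNorm v 1 μ + eLpNorm (fun x => a x - v x) 1 μ := by
    intro F _ μ a v ha hv
    calc eLpNorm a 1 μ = eLpNorm (v + fun x => a x - v x) 1 μ := by
          congr 1
          ext x
          simp
      _ ≤ _ := eLpNorm_add_le hv (ha.sub hv) le_rfl
  have hbound : ∀ k, eLpNorm t 1 (surfaceMeasure Ω) ≤
      C * ((eLpNorm u 1 (volume.restrict Ω) +
          eLpNorm (fun x => f k x - u x) 1 (volume.restrict Ω)) +
        (eLpNorm g 1 (volume.restrict Ω) +
          eLpNorm (fun x => ∇ (f k) x - g x) 1 (volume.restrict Ω))) +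
      eLpNorm (fun x => f k x - t x) 1 (surfaceMeasure Ω) := by
    intro k
    calc eLpNorm t 1 (surfaceMeasure Ω) ≤ eLpNorm (f k) 1 (surfaceMeasure Ω) +
          eLpNorm (fun x => t x - f k x) 1 (surfaceMeasure Ω) := htri h.memLp_trace.1 (hftm k).1
      _ ≤ _ := by
        rw [show (fun x => t x - f k x) = t - f k from rfl, eLpNorm_sub_comm]
        refine add_le_add ?_ le_rfl
        have h2 := hle (f k) (hf k)
        rw [lintegral_add_left (hf k).continuous.enorm.measurable] at h2
        simp only [← eLpNorm_one_eq_lintegral_enorm] at h2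
        refine h2.trans ?_
        gcongr
        · exact htri (hfm k).1 h.memLp.1
        · exact htri (hfgm k).1 h.memLp_gradient.1
  refine ge_of_tendsto' (x := atTop) ?_ hbound
  have hlim := (ENNReal.Tendsto.const_mul ((hfu1.const_add (eLpNorm u 1 (volume.restrict Ω))).add
    (hfg1.const_add (eLpNorm g 1 (volume.restrict Ω)))) (Or.inr hC)).add hft1
  simp only [add_zero] at hlim
  exact hlim

theorem HasSobolevTrace.trace_ae_eq_zero (hn : 1 ≤ n) (hΩ : IsBoundedLipschitzDomain Ω)
    {u t : EuclideanSpace ℝ (Fin n) → ℝ} {g : EuclideanSpace ℝ (Fin n) → EuclideanSpace ℝ (Fin n)}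
    (h : HasSobolevTrace Ω u g t) (hu : u =ᵐ[volume.restrict Ω] 0)
    (hg : g =ᵐ[volume.restrict Ω] 0) : t =ᵐ[surfaceMeasure Ω] 0 := by
  obtain ⟨C, -, hle⟩ := exists_eLpNorm_trace_le hn hΩ
  have h1 := hle u g t h
  rw [eLpNorm_congr_ae hu, eLpNorm_congr_ae hg, eLpNorm_zero, eLpNorm_zero, add_zero, mul_zero,
    nonpos_iff_eq_zero] at h1
  exact (eLpNorm_eq_zero_iff h.memLp_trace.1 one_ne_zero).1 h1

/-- The difference of the two traces is a trace of the zero function, which the trace inequality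
kills. -/
theorem HasSobolevTrace.trace_unique (hn : 1 ≤ n) (hΩ : IsBoundedLipschitzDomain Ω)
    {u t t' : EuclideanSpace ℝ (Fin n) → ℝ}
    {g : EuclideanSpace ℝ (Fin n) → EuclideanSpace ℝ (Fin n)}
    (h : HasSobolevTrace Ω u g t) (h' : HasSobolevTrace Ω u g t') :
    t =ᵐ[surfaceMeasure Ω] t' := by
  have h0 := (h.sub hn hΩ h').trace_ae_eq_zero hn hΩ (by simp; rfl) (by simp; rfl)
  filter_upwards [h0] with x hx
  exact sub_eq_zero.1 hx

theorem HasSobolevTrace.mul_contDiff (hΩ : IsBoundedLipschitzDomain Ω)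
    {u t : EuclideanSpace ℝ (Fin n) → ℝ} {g : EuclideanSpace ℝ (Fin n) → EuclideanSpace ℝ (Fin n)}
    (h : HasSobolevTrace Ω u g t) {q : EuclideanSpace ℝ (Fin n) → ℝ} (hq : ContDiff ℝ ∞ q) :
    HasSobolevTrace Ω (fun x => q x * u x) (fun x => q x • g x + u x • ∇ q x)
      (fun x => q x * t x) := by
  obtain ⟨f, hf, hfu, hfg, hft⟩ := h.exists_approx
  obtain ⟨M, hM⟩ := exists_bound_closure hΩ.isBounded hq.continuous
  obtain ⟨M', hM'⟩ := exists_bound_closure hΩ.isBounded hq.continuous_gradient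
  have hbd : ∀ {F F' : Type} [NormedAddCommGroup F] [NormedAddCommGroup F']
      {μ : Measure (EuclideanSpace ℝ (Fin n))} {a : ℕ → EuclideanSpace ℝ (Fin n) → F}
      {b : ℕ → EuclideanSpace ℝ (Fin n) → F'} {N : ℝ},
      Tendsto (fun k => eLpNorm (a k) 2 μ) atTop (𝓝 0) →
      (∀ k, ∀ᵐ x ∂μ, ‖b k x‖ ≤ N * ‖a k x‖) →
      Tendsto (fun k => eLpNorm (b k) 2 μ) atTop (𝓝 0) := by
    intro F F' _ _ μ a b N ha hb
    refine tendsto_of_tendsto_of_tendsto_of_le_of_le tendsto_const_nhds ?_ (fun _ => zero_le)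
      fun k => eLpNorm_le_mul_eLpNorm_of_ae_le_mul (hb k) 2
    simpa using ENNReal.Tendsto.const_mul ha (Or.inr ENNReal.ofReal_ne_top)
  have hcl := ae_restrict_mem_closure hΩ.isOpen
  have hcl' := ae_surfaceMeasure_mem_closure (Ω := Ω)
  have hm1 : MemLp (fun x => q x * u x) 2 (volume.restrict Ω) :=
    (h.memLp.of_le_mul (c := M) (hq.continuous.aestronglyMeasurable.mul h.memLp.1)
      (hcl.mono fun x hx => by rw [norm_mul]; gcongr; exact hM x hx))
  have hm2 : MemLp (fun x => q x • g x) 2 (volume.restrict Ω) :=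
    (h.memLp_gradient.of_le_mul (c := M)
      (hq.continuous.aestronglyMeasurable.smul h.memLp_gradient.1)
      (hcl.mono fun x hx => by rw [norm_smul]; gcongr; exact hM x hx))
  have hm3 : MemLp (fun x => u x • ∇ q x) 2 (volume.restrict Ω) :=
    (h.memLp.of_le_mul (c := M')
      (h.memLp.1.smul hq.continuous_gradient.aestronglyMeasurable)
      (hcl.mono fun x hx => by rw [norm_smul, mul_comm]; gcongr; exact hM' x hx))
  have hm4 : MemLp (fun x => q x * t x) 2 (surfaceMeasure Ω) :=
    (h.memLp_trace.of_le_mul (c := M) (hq.continuous.aestronglyMeasurable.mul h.memLp_trace.1)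
      (hcl'.mono fun x hx => by rw [norm_mul]; gcongr; exact hM x hx))
  refine ⟨hm1, hm2.add hm3, hm4, fun k x => q x * f k x, fun k => hq.mul (hf k), ?_, ?_, ?_⟩
  · refine hbd (N := M) hfu fun k => hcl.mono fun x hx => ?_
    rw [← mul_sub, norm_mul]
    gcongr
    exact hM x hx
  · have h1 : Tendsto (fun k => eLpNorm (fun x => q x • (∇ (f k) x - g x)) 2 (volume.restrict Ω))
        atTop (𝓝 0) := by
      refine hbd (N := M) hfg fun k => hcl.mono fun x hx => ?_
      rw [norm_smul]
      gcongr
      exact hM x hx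
    have h2 : Tendsto (fun k => eLpNorm (fun x => (f k x - u x) • ∇ q x) 2 (volume.restrict Ω))
        atTop (𝓝 0) := by
      refine hbd (N := M') hfu fun k => hcl.mono fun x hx => ?_
      rw [norm_smul, mul_comm]
      gcongr
      exact hM' x hx
    refine tendsto_of_tendsto_of_tendsto_of_le_of_le tendsto_const_nhds
      (by simpa using h1.add h2) (fun _ => zero_le) fun k => ?_
    have h4 : (fun x => ∇ (fun x => q x * f k x) x - (q x • g x + u x • ∇ q x)) =
        (fun x => q x • (∇ (f k) x - g x)) + fun x => (f k x - u x) • ∇ q x := by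
      ext1 x
      rw [gradient_mul hq (hf k)]
      simp only [Pi.add_apply]
      module
    rw [h4]
    exact eLpNorm_add_le (hq.continuous.aestronglyMeasurable.smul
        ((hf k).continuous_gradient.aestronglyMeasurable.sub h.memLp_gradient.1))
      (((hf k).continuous.aestronglyMeasurable.sub h.memLp.1).smul
        hq.continuous_gradient.aestronglyMeasurable) (by norm_num)
  · refine hbd (N := M) hft fun k => hcl'.mono fun x hx => ?_
    rw [← mul_sub, norm_mul]
    gcongr
    exact hM x hx

/-- Chain rule: composition of an `H¹` function with a smooth function of bounded derivative. -/
theorem HasSobolevTrace.comp (hn : 1 ≤ n) (hΩ : IsBoundedLipschitzDomain Ω)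
    {u t : EuclideanSpace ℝ (Fin n) → ℝ} {g : EuclideanSpace ℝ (Fin n) → EuclideanSpace ℝ (Fin n)}
    (h : HasSobolevTrace Ω u g t) {G : ℝ → ℝ} (hG : ContDiff ℝ ∞ G) {M : ℝ}
    (hM : ∀ s, |deriv G s| ≤ M) :
    HasSobolevTrace Ω (fun x => G (u x)) (fun x => deriv G (u x) • g x) (fun x => G (t x)) := by
  have := hΩ.isFiniteMeasure_restrict
  have := hΩ.isFiniteMeasure_surfaceMeasure hn
  have hLip : ∀ a b, ‖G a - G b‖ ≤ M * ‖a - b‖ := fun a b =>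
    Convex.norm_image_sub_le_of_norm_deriv_le (s := Set.univ)
      (fun x _ => hG.differentiable (by simp) x) (fun x _ => hM x) convex_univ trivial trivial
  have hG' : Continuous (deriv G) := hG.continuous_deriv (by simp)
  -- G grows at most linearly, and the constant G 0 is square integrable because the measure is
  -- finite.
  have hmem : ∀ {μ : Measure (EuclideanSpace ℝ (Fin n))} [IsFiniteMeasure μ]
      {v : EuclideanSpace ℝ (Fin n) → ℝ}, MemLp v 2 μ → MemLp (fun x => G (v x)) 2 μ := by
    intro μ _ v hv
    have h1 : MemLp (fun x => G (v x) - G 0) 2 μ := by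
      refine hv.of_le_mul (c := M) ((hG.continuous.comp_aestronglyMeasurable hv.1).sub
        aestronglyMeasurable_const) (Eventually.of_forall fun x => ?_)
      simpa using hLip (v x) 0
    refine (h1.add (memLp_const (G 0))).ae_eq (Eventually.of_forall fun x => ?_)
    simp
  obtain ⟨f, hf, hfu, hfg, hft⟩ := h.exists_approx
  have hfm := fun k => hΩ.memLp_of_continuous (hf k).continuous 2
  -- The factor G'(fₖ) in the gradient converges only through continuity of G', which needs almost
  -- everywhere convergence, hence a subsequence.
  obtain ⟨ns, hns, hae⟩ := (tendstoInMeasure_of_tendsto_eLpNorm (by norm_num)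
    (fun k => (hfm k).1) h.memLp.1 hfu).exists_seq_tendsto_ae
  have hnst := hns.tendsto_atTop
  have hconv : ∀ {μ : Measure (EuclideanSpace ℝ (Fin n))} {v : EuclideanSpace ℝ (Fin n) → ℝ},
      Tendsto (fun k => eLpNorm (fun x => f k x - v x) 2 μ) atTop (𝓝 0) →
      Tendsto (fun k => eLpNorm (fun x => G (f (ns k) x) - G (v x)) 2 μ) atTop (𝓝 0) := by
    intro μ v hv
    refine tendsto_of_tendsto_of_tendsto_of_le_of_le tendsto_const_nhds ?_ (fun _ => zero_le)
      fun k => eLpNorm_le_mul_eLpNorm_of_ae_le_mul (Eventually.of_forall fun x =>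
        hLip (f (ns k) x) (v x)) 2
    simpa using ENNReal.Tendsto.const_mul (hv.comp hnst) (Or.inr ENNReal.ofReal_ne_top)
  refine ⟨hmem h.memLp, ?_, hmem h.memLp_trace, fun k x => G (f (ns k) x),
    fun k => hG.comp (hf (ns k)), hconv hfu, ?_, hconv hft⟩
  · refine h.memLp_gradient.of_le_mul (c := M) ((hG'.comp_aestronglyMeasurable h.memLp.1).smul
      h.memLp_gradient.1) (Eventually.of_forall fun x => ?_)
    rw [norm_smul]
    gcongr
    exact hM _
  · simp only [gradient_comp hG (hf _)]
    refine tendsto_eLpNorm_smul_of_tendsto_ae (M := M)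
      (fun k => (hG'.comp (hf (ns k)).continuous).aestronglyMeasurable)
      (hG'.comp_aestronglyMeasurable h.memLp.1) (fun k => Eventually.of_forall fun x => hM _)
      (Eventually.of_forall fun x => hM _) ?_
      (fun k => (hf (ns k)).continuous_gradient.aestronglyMeasurable) h.memLp_gradient
      (hfg.comp hnst)
    filter_upwards [hae] with x hx
    exact (hG'.tendsto _).comp hx

end SobolevTrace

/-! ### A smooth positive substitute for s + ε -/

section SmoothShift

/-- A smooth function with values at least `ε / 2` which equals `s + ε` for `s ≥ 0`. -/
noncomputable def smoothShift (ε s : ℝ) : ℝ := s * Real.smoothTransition (2 * s / ε + 1) + ε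

variable {ε : ℝ}

theorem smoothShift_of_nonneg (hε : 0 < ε) {s : ℝ} (hs : 0 ≤ s) : smoothShift ε s = s + ε := by
  have h1 : (1 : ℝ) ≤ 2 * s / ε + 1 := by
    have : 0 ≤ 2 * s / ε := by positivity
    linarith
  rw [smoothShift, Real.smoothTransition.one_of_one_le h1, mul_one]

theorem smoothShift_of_le (hε : 0 < ε) {s : ℝ} (hs : s ≤ -(ε / 2)) : smoothShift ε s = ε := by
  have h1 : 2 * s / ε + 1 ≤ 0 := by
    have : 2 * s / ε ≤ -1 := by
      rw [div_le_iff₀ hε]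
      linarith
    linarith
  rw [smoothShift, Real.smoothTransition.zero_of_nonpos h1, mul_zero, zero_add]

theorem half_le_smoothShift (hε : 0 < ε) (s : ℝ) : ε / 2 ≤ smoothShift ε s := by
  rcases le_total s (-(ε / 2)) with h | h
  · rw [smoothShift_of_le hε h]
    linarith
  rcases le_total 0 s with h0 | h0
  · rw [smoothShift_of_nonneg hε h0]
    linarith
  · have h1 := Real.smoothTransition.le_one (2 * s / ε + 1)
    have h2 : s ≤ s * Real.smoothTransition (2 * s / ε + 1) := by nlinarith
    unfold smoothShift
    linarith

theorem smoothShift_pos (hε : 0 < ε) (s : ℝ) : 0 < smoothShift ε s :=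
  (half_pos hε).trans_le (half_le_smoothShift hε s)

theorem contDiff_smoothShift : ContDiff ℝ ∞ (smoothShift ε) := by
  have h : ContDiff ℝ ∞ fun s : ℝ => Real.smoothTransition (2 * s / ε + 1) :=
    Real.smoothTransition.contDiff.comp (by fun_prop)
  exact (contDiff_id.mul h).add contDiff_const

theorem deriv_smoothShift_of_pos (hε : 0 < ε) {s : ℝ} (hs : 0 < s) :
    deriv (smoothShift ε) s = 1 := by
  have h : smoothShift ε =ᶠ[𝓝 s] fun s => s + ε := by
    filter_upwards [lt_mem_nhds hs] with r hr
    exact smoothShift_of_nonneg hε hr.le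
  rw [h.deriv_eq]
  simp

/-- The derivative is 0 to the left of -ε/2 and 1 to the right of 0; compactness covers the interval
between. -/
theorem exists_abs_deriv_smoothShift_le (hε : 0 < ε) :
    ∃ M, ∀ s, |deriv (smoothShift ε) s| ≤ M := by
  obtain ⟨M, hM⟩ := (isCompact_Icc (a := -(ε / 2)) (b := 0)).exists_bound_of_continuousOn
    ((contDiff_smoothShift (ε := ε)).continuous_deriv (by simp)).continuousOn
  refine ⟨max M 1, fun s => ?_⟩
  rcases lt_or_ge s (-(ε / 2)) with h | h
  · have h1 : smoothShift ε =ᶠ[𝓝 s] fun _ => ε := by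
      filter_upwards [gt_mem_nhds h] with r hr
      exact smoothShift_of_le hε hr.le
    rw [h1.deriv_eq]
    simp
  rcases lt_or_ge 0 s with h0 | h0
  · rw [deriv_smoothShift_of_pos hε h0, abs_one]
    exact le_max_right _ _
  · exact (hM s ⟨h, h0⟩).trans (le_max_left _ _)

theorem contDiff_inv_smoothShift (hε : 0 < ε) : ContDiff ℝ ∞ fun s => (smoothShift ε s)⁻¹ :=
  contDiff_smoothShift.inv fun s => (smoothShift_pos hε s).ne'

theorem deriv_inv_smoothShift (hε : 0 < ε) (s : ℝ) :
    deriv (fun s => (smoothShift ε s)⁻¹) s = -deriv (smoothShift ε) s / smoothShift ε s ^ 2 :=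
  deriv_fun_inv'' (contDiff_smoothShift.differentiable (by simp) s) (smoothShift_pos hε s).ne'

theorem exists_abs_deriv_inv_smoothShift_le (hε : 0 < ε) :
    ∃ M, ∀ s, |deriv (fun s => (smoothShift ε s)⁻¹) s| ≤ M := by
  obtain ⟨M, hM⟩ := exists_abs_deriv_smoothShift_le hε
  refine ⟨M / (ε / 2) ^ 2, fun s => ?_⟩
  rw [deriv_inv_smoothShift hε, abs_div, abs_neg, abs_of_pos (pow_pos (smoothShift_pos hε s) 2)]
  have h1 := half_le_smoothShift hε s
  have h2 : 0 ≤ M := (abs_nonneg _).trans (hM s)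
  gcongr
  exact hM s

theorem contDiff_log_smoothShift (hε : 0 < ε) : ContDiff ℝ ∞ fun s => Real.log (smoothShift ε s) :=
  contDiff_smoothShift.log fun s => (smoothShift_pos hε s).ne'

theorem deriv_log_smoothShift (hε : 0 < ε) (s : ℝ) :
    deriv (fun s => Real.log (smoothShift ε s)) s = deriv (smoothShift ε) s / smoothShift ε s :=
  deriv.log (contDiff_smoothShift.differentiable (by simp) s) (smoothShift_pos hε s).ne'

theorem exists_abs_deriv_log_smoothShift_le (hε : 0 < ε) :
    ∃ M, ∀ s, |deriv (fun s => Real.log (smoothShift ε s)) s| ≤ M := by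
  obtain ⟨M, hM⟩ := exists_abs_deriv_smoothShift_le hε
  refine ⟨M / (ε / 2), fun s => ?_⟩
  rw [deriv_log_smoothShift hε, abs_div, abs_of_pos (smoothShift_pos hε s)]
  have h1 := half_le_smoothShift hε s
  have h2 : 0 ≤ M := (abs_nonneg _).trans (hM s)
  gcongr
  exact hM s

end SmoothShift

/-! ### Integrability of products and weighted squares -/

section Integrability

variable {α F : Type*} [MeasurableSpace α] {μ : Measure α} [NormedAddCommGroup F]

theorem MeasureTheory.MemLp.integrable_inner [InnerProductSpace ℝ F] {a b : α → F}
    (ha : MemLp a 2 μ) (hb : MemLp b 2 μ) : Integrable (fun x => inner ℝ (a x) (b x)) μ := by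
  refine (L2.integrable_inner (𝕜 := ℝ) (ha.toLp a) (hb.toLp b)).congr ?_
  filter_upwards [ha.coeFn_toLp, hb.coeFn_toLp] with x hx hy
  rw [hx, hy]

theorem MeasureTheory.MemLp.exists_ae_norm_le {a : α → F} (ha : MemLp a ⊤ μ) :
    ∃ M, 0 ≤ M ∧ ∀ᵐ x ∂μ, ‖a x‖ ≤ M := by
  have hne : eLpNormEssSup a μ ≠ ⊤ := by
    rw [← eLpNorm_exponent_top]
    exact ha.eLpNorm_ne_top
  refine ⟨(eLpNormEssSup a μ).toReal, ENNReal.toReal_nonneg, ?_⟩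
  filter_upwards [ae_le_eLpNormEssSup (f := a) (μ := μ)] with x hx
  rw [← toReal_enorm]
  exact ENNReal.toReal_mono hne hx

/-- Convergence of weighted squares under `L²` convergence. -/
theorem tendsto_integral_mul_sq {a : α → ℝ} {f : ℕ → α → ℝ} {u : α → ℝ} (ha : MemLp a ⊤ μ)
    (hf : ∀ k, MemLp (f k) 2 μ) (hu : MemLp u 2 μ)
    (hfu : Tendsto (fun k => eLpNorm (fun x => f k x - u x) 2 μ) atTop (𝓝 0)) :
    Tendsto (fun k => ∫ x, a x * f k x ^ 2 ∂μ) atTop (𝓝 (∫ x, a x * u x ^ 2 ∂μ)) := by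
  obtain ⟨M, -, hM⟩ := ha.exists_ae_norm_le
  have h1 := tendsto_eLpNorm_smul_of_tendsto_ae (a := fun _ => a) (a' := a) (fun _ => ha.1) ha.1
    (fun _ => hM) hM (by simp) (fun k => (hf k).1) hu hfu
  have h2 := tendsto_integral_mul_of_tendsto_eLpNorm (fun k => (hf k).mul ha) (hu.mul ha)
    hf hu h1 hfu
  simpa [pow_two, mul_assoc] using h2

end Integrability

/-! ### Positive solutions: positivity of the trace and Picone's inequality -/

section Robin

variable {n : ℕ} {Ω : Set (EuclideanSpace ℝ (Fin n))} {m β : EuclideanSpace ℝ (Fin n) → ℝ} {Λ : ℝ}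
  {φ : EuclideanSpace ℝ (Fin n) → ℝ} {g : EuclideanSpace ℝ (Fin n) → EuclideanSpace ℝ (Fin n)}
  {t : EuclideanSpace ℝ (Fin n) → ℝ}

/-- `φ`, with weak gradient `g` and trace `t`, is a positive weak solution of the Robin problem. -/
structure IsPositiveRobinSolution (Ω : Set (EuclideanSpace ℝ (Fin n)))
    (m β : EuclideanSpace ℝ (Fin n) → ℝ) (Λ : ℝ) (φ : EuclideanSpace ℝ (Fin n) → ℝ)
    (g : EuclideanSpace ℝ (Fin n) → EuclideanSpace ℝ (Fin n))
    (t : EuclideanSpace ℝ (Fin n) → ℝ) : Prop where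
  hasSobolevTrace : HasSobolevTrace Ω φ g t
  pos : ∀ᵐ x ∂(volume.restrict Ω), 0 < φ x
  integral_eq : ∀ ψ g' t', HasSobolevTrace Ω ψ g' t' →
    (∫ x in Ω, inner ℝ (g x) (g' x)) + (∫ x, β x * t x * t' x ∂(surfaceMeasure Ω))
      = Λ * ∫ x in Ω, m x * φ x * ψ x

theorem IsPrincipalEigenpair.exists_isPositiveRobinSolution (hΩ : IsBoundedLipschitzDomain Ω)
    (h : IsPrincipalEigenpair Ω m β Λ φ) : ∃ g t, IsPositiveRobinSolution Ω m β Λ φ g t := by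
  obtain ⟨g, t, hg, ht, heq⟩ := h.weak_solution
  exact ⟨g, t, ht.hasSobolevTrace hΩ hg, h.pos,
    fun ψ g' t' h' => heq ψ g' t' (h'.hasH1Gradient hΩ) (h'.isTrace hΩ)⟩

/-- Compose with a smooth G that vanishes on s ≥ 0 and is positive on s < 0. Then G(φ) and its
gradient vanish, so its trace G(t) does too. -/
theorem HasSobolevTrace.trace_nonneg (hn : 1 ≤ n) (hΩ : IsBoundedLipschitzDomain Ω)
    (h : HasSobolevTrace Ω φ g t) (hφ : ∀ᵐ x ∂(volume.restrict Ω), 0 < φ x) :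
    ∀ᵐ x ∂(surfaceMeasure Ω), 0 ≤ t x := by
  obtain ⟨M, hM⟩ := exists_abs_deriv_smoothShift_le one_pos
  let G : ℝ → ℝ := fun s => smoothShift 1 s - (s + 1)
  have hG : ContDiff ℝ ∞ G := contDiff_smoothShift.sub (by fun_prop)
  have hd : ∀ s, deriv G s = deriv (smoothShift 1) s - 1 := fun s => by
    have h1 : HasDerivAt (smoothShift 1) (deriv (smoothShift 1) s) s :=
      (contDiff_smoothShift.differentiable (by simp) s).hasDerivAt
    exact (h1.sub ((hasDerivAt_id' s).add_const (1 : ℝ))).deriv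
  have h1 := h.comp hn hΩ hG (M := M + 1) fun s => by
    rw [hd]
    calc |deriv (smoothShift 1) s - 1| ≤ |deriv (smoothShift 1) s| + |1| := abs_sub _ _
      _ ≤ M + 1 := by
        rw [abs_one]
        linarith [hM s]
  have h2 := h1.trace_ae_eq_zero hn hΩ
    (by
      filter_upwards [hφ] with x hx
      simp [G, smoothShift_of_nonneg one_pos hx.le])
    (by
      filter_upwards [hφ] with x hx
      simp [hd, deriv_smoothShift_of_pos one_pos hx])
  filter_upwards [h2] with x hx
  by_contra! hneg
  simp only [G, smoothShift, Pi.zero_apply] at hx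
  have h3 := Real.smoothTransition.lt_one_of_lt_one (x := 2 * t x / 1 + 1) (by linarith)
  nlinarith

/-- Testing the equation with `q² / (φ + ε)`. -/
theorem IsPositiveRobinSolution.integral_sq_div_add (hn : 1 ≤ n) (hΩ : IsBoundedLipschitzDomain Ω)
    (h : IsPositiveRobinSolution Ω m β Λ φ g t) {q : EuclideanSpace ℝ (Fin n) → ℝ}
    (hq : ContDiff ℝ ∞ q) {ε : ℝ} (hε : 0 < ε) :
    Integrable (fun x => 2 * inner ℝ ((q x / (φ x + ε)) • g x) (∇ q x) -
      ‖(q x / (φ x + ε)) • g x‖ ^ 2) (volume.restrict Ω) ∧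
    (∫ x in Ω, (2 * inner ℝ ((q x / (φ x + ε)) • g x) (∇ q x) -
      ‖(q x / (φ x + ε)) • g x‖ ^ 2)) +
      (∫ x, β x * (t x / (t x + ε) * q x ^ 2) ∂(surfaceMeasure Ω))
      = Λ * ∫ x in Ω, m x * (φ x / (φ x + ε) * q x ^ 2) := by
  obtain ⟨M, hM⟩ := exists_abs_deriv_inv_smoothShift_le hε
  -- The chain rule asks for a function smooth on all of ℝ with bounded derivative, which 1/(s + ε)
  -- is not; its substitute agrees with it on s ≥ 0, where φ and t take their values.
  have h1 := (h.hasSobolevTrace.comp hn hΩ (contDiff_inv_smoothShift hε) hM).mul_contDiff hΩ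
    (hq.mul hq)
  have heq : (fun x => inner ℝ (g x) ((q x * q x) • deriv (fun s => (smoothShift ε s)⁻¹) (φ x) • g x
      + (smoothShift ε (φ x))⁻¹ • ∇ (fun y => q y * q y) x)) =ᵐ[volume.restrict Ω]
      fun x => 2 * inner ℝ ((q x / (φ x + ε)) • g x) (∇ q x) -
      ‖(q x / (φ x + ε)) • g x‖ ^ 2 := by
    filter_upwards [h.pos] with x hx
    have hne : φ x + ε ≠ 0 := by positivity
    rw [gradient_mul hq hq, deriv_inv_smoothShift hε, deriv_smoothShift_of_pos hε hx,
      smoothShift_of_nonneg hε hx.le, norm_smul, mul_pow, Real.norm_eq_abs, sq_abs]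
    simp only [inner_add_right, inner_smul_right, real_inner_smul_left, real_inner_self_eq_norm_sq]
    field_simp
    ring
  refine ⟨(h.hasSobolevTrace.memLp_gradient.integrable_inner h1.memLp_gradient).congr heq, ?_⟩
  rw [← integral_congr_ae heq]
  have heq' : (fun x => β x * (t x / (t x + ε) * q x ^ 2)) =ᵐ[surfaceMeasure Ω]
      fun x => β x * t x * (q x * q x * (smoothShift ε (t x))⁻¹) := by
    filter_upwards [h.hasSobolevTrace.trace_nonneg hn hΩ h.pos] with x hx
    rw [smoothShift_of_nonneg hε hx]
    ring
  have heq'' : (fun x => m x * (φ x / (φ x + ε) * q x ^ 2)) =ᵐ[volume.restrict Ω]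
      fun x => m x * φ x * (q x * q x * (smoothShift ε (φ x))⁻¹) := by
    filter_upwards [h.pos] with x hx
    rw [smoothShift_of_nonneg hε hx.le]
    ring
  rw [integral_congr_ae heq', integral_congr_ae heq'']
  exact h.integral_eq _ _ _ h1

theorem abs_div_add_mul_le {s ε c : ℝ} (hs : 0 ≤ s) (hε : 0 < ε) (b : ℝ) (hc : 0 ≤ c) :
    ‖b * (s / (s + ε) * c)‖ ≤ ‖b‖ * c := by
  have h1 : s / (s + ε) ≤ 1 := (div_le_one (by positivity)).2 (by linarith)
  have h2 : 0 ≤ s / (s + ε) * c := mul_nonneg (div_nonneg hs (by positivity)) hc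
  rw [norm_mul, Real.norm_of_nonneg h2]
  exact mul_le_mul_of_nonneg_left (mul_le_of_le_one_left hc h1) (norm_nonneg b)

/-- The functions `log (φ + ε)` have gradients bounded in `L²` uniformly in `ε`. -/
theorem IsPositiveRobinSolution.exists_eLpNorm_gradient_log_le (hn : 1 ≤ n)
    (hΩ : IsBoundedLipschitzDomain Ω) (h : IsPositiveRobinSolution Ω m β Λ φ g t)
    (hm : MemLp m ⊤ (volume.restrict Ω)) (hβ : MemLp β ⊤ (surfaceMeasure Ω)) :
    ∃ K : ENNReal, K ≠ ⊤ ∧ ∀ ε : ℝ, 0 < ε →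
      eLpNorm (fun x => (φ x + ε)⁻¹ • g x) 2 (volume.restrict Ω) ≤ K := by
  have := hΩ.isFiniteMeasure_restrict
  have := hΩ.isFiniteMeasure_surfaceMeasure hn
  have hmi : Integrable m (volume.restrict Ω) := hm.integrable le_top
  have hβi : Integrable β (surfaceMeasure Ω) := hβ.integrable le_top
  -- For q = 1 the tested identity expresses ∫|∇φ|²/(φ + ε)² through the β and m terms, whose
  -- factors t/(t + ε) and φ/(φ + ε) are at most 1.
  set C : ℝ := (∫ x, ‖β x‖ ∂(surfaceMeasure Ω)) + |Λ| * ∫ x in Ω, ‖m x‖ with hC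
  refine ⟨ENNReal.ofReal (C ^ (2 : ℝ)⁻¹), ENNReal.ofReal_ne_top, fun ε hε => ?_⟩
  obtain ⟨-, h1⟩ := h.integral_sq_div_add hn hΩ (q := fun _ => 1) contDiff_const hε
  have hg : ∀ x : EuclideanSpace ℝ (Fin n), ∇ (fun _ : EuclideanSpace ℝ (Fin n) => (1 : ℝ)) x = 0 :=
    fun x => by simp [gradient]
  simp only [hg, inner_zero_right, mul_zero, zero_sub, one_div, integral_neg, one_pow] at h1
  have hb : |∫ x, β x * (t x / (t x + ε) * 1) ∂(surfaceMeasure Ω)| ≤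
      ∫ x, ‖β x‖ ∂(surfaceMeasure Ω) := by
    rw [← Real.norm_eq_abs]
    refine norm_integral_le_of_norm_le hβi.norm ?_
    filter_upwards [h.hasSobolevTrace.trace_nonneg hn hΩ h.pos] with x hx
    simpa using abs_div_add_mul_le hx hε (β x) zero_le_one
  have hb' : |∫ x in Ω, m x * (φ x / (φ x + ε) * 1)| ≤ ∫ x in Ω, ‖m x‖ := by
    rw [← Real.norm_eq_abs]
    refine norm_integral_le_of_norm_le hmi.norm ?_
    filter_upwards [h.pos] with x hx
    simpa using abs_div_add_mul_le hx.le hε (m x) zero_le_one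
  have hle : ∫ x in Ω, ‖(φ x + ε)⁻¹ • g x‖ ^ 2 ≤ C := by
    have h3 : |Λ * ∫ x in Ω, m x * (φ x / (φ x + ε) * 1)| ≤ |Λ| * ∫ x in Ω, ‖m x‖ := by
      rw [abs_mul]
      gcongr
    have h4 := (abs_le.1 h3).1
    have h5 := (abs_le.1 hb).2
    linarith
  have hmem : MemLp (fun x => (φ x + ε)⁻¹ • g x) 2 (volume.restrict Ω) := by
    have hφm : AEMeasurable φ (volume.restrict Ω) := h.hasSobolevTrace.memLp.1.aemeasurable
    refine h.hasSobolevTrace.memLp_gradient.of_le_mul (c := ε⁻¹)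
      ((hφm.add_const ε).inv.aestronglyMeasurable.smul h.hasSobolevTrace.memLp_gradient.1) ?_
    filter_upwards [h.pos] with x hx
    rw [norm_smul, Real.norm_of_nonneg (by positivity)]
    gcongr
    linarith
  rw [hmem.eLpNorm_eq_integral_rpow_norm (by norm_num) (by norm_num)]
  refine ENNReal.ofReal_le_ofReal ?_
  simp only [ENNReal.toReal_ofNat, Real.rpow_ofNat]
  exact Real.rpow_le_rpow (integral_nonneg fun x => by positivity) hle (by norm_num)

/-- The scaling fixes the value of c log(s + ε) at s = 0 while c tends to 0. -/
theorem exists_seq_mul_log_eq_neg_one :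
    ∃ ε c : ℕ → ℝ, (∀ k, 0 < ε k) ∧ (∀ k, ε k ≤ 1) ∧ Tendsto ε atTop (𝓝 0) ∧ (∀ k, 0 < c k) ∧
      (∀ k, c k ≤ 1) ∧ Tendsto c atTop (𝓝 0) ∧ ∀ k, c k * Real.log (ε k) = -1 := by
  refine ⟨fun k => Real.exp (-((k : ℝ) + 1)), fun k => ((k : ℝ) + 1)⁻¹, fun k => Real.exp_pos _,
    fun k => Real.exp_le_one_iff.2 (by linarith [k.cast_nonneg (α := ℝ)]), ?_,
    fun k => by positivity,
    fun k => inv_le_one_of_one_le₀ (by linarith [k.cast_nonneg (α := ℝ)]),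
    by simpa using tendsto_one_div_add_atTop_nhds_zero_nat (𝕜 := ℝ), fun k => ?_⟩
  · refine Real.tendsto_exp_atBot.comp (tendsto_neg_atTop_atBot.comp ?_)
    exact tendsto_atTop_add_const_right _ _ tendsto_natCast_atTop_atTop
  · have : (k : ℝ) + 1 ≠ 0 := by positivity
    rw [Real.log_exp]
    field_simp

/-- A dominating function free of ε and c: the lower bound -1 is the value at s = 0, the upper bound
comes from log x ≤ x - 1. -/
theorem abs_mul_log_add_le {s ε c : ℝ} (hs : 0 ≤ s) (hε : 0 < ε) (hε1 : ε ≤ 1) (hc : 0 ≤ c)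
    (hc1 : c ≤ 1) (hlog : c * Real.log ε = -1) : |c * Real.log (s + ε)| ≤ 1 + s := by
  have h1 : Real.log ε ≤ Real.log (s + ε) := Real.log_le_log hε (by linarith)
  have h2 : Real.log (s + ε) ≤ s :=
    (Real.log_le_sub_one_of_pos (by linarith)).trans (by linarith)
  have h3 := mul_le_mul_of_nonneg_left h1 hc
  have h4 := mul_le_mul_of_nonneg_left h2 hc
  have h5 := mul_le_mul_of_nonneg_right hc1 hs
  exact abs_le.2 ⟨by linarith, by linarith⟩

/-- The trace of a positive solution is positive almost everywhere on the boundary. -/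
theorem IsPositiveRobinSolution.trace_pos (hn : 1 ≤ n) (hΩ : IsBoundedLipschitzDomain Ω)
    (h : IsPositiveRobinSolution Ω m β Λ φ g t)
    (hm : MemLp m ⊤ (volume.restrict Ω)) (hβ : MemLp β ⊤ (surfaceMeasure Ω)) :
    ∀ᵐ x ∂(surfaceMeasure Ω), 0 < t x := by
  have := hΩ.isFiniteMeasure_restrict
  obtain ⟨K, hK, hKle⟩ := h.exists_eLpNorm_gradient_log_le hn hΩ hm hβ
  obtain ⟨C, hC, hCle⟩ := exists_eLpNorm_trace_le hn hΩ
  have hT := h.hasSobolevTrace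
  obtain ⟨ε, c, hε, hε1, hε0, hc, hc1, hc0, hεlog⟩ := exists_seq_mul_log_eq_neg_one
  have htr : ∀ k, HasSobolevTrace Ω (fun x => c k * Real.log (smoothShift (ε k) (φ x)))
      (fun x => (c k) • deriv (fun s => Real.log (smoothShift (ε k) s)) (φ x) • g x)
      (fun x => c k * Real.log (smoothShift (ε k) (t x))) := by
    intro k
    obtain ⟨M, hM⟩ := exists_abs_deriv_log_smoothShift_le (hε k)
    have h1 := (hT.comp hn hΩ (contDiff_log_smoothShift (hε k)) hM).mul_contDiff hΩ
      (q := fun _ => c k) contDiff_const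
    simpa [gradient] using h1
  have hu : Tendsto (fun k => eLpNorm (fun x => c k * Real.log (smoothShift (ε k) (φ x))) 1
      (volume.restrict Ω)) atTop (𝓝 0) := by
    refine tendsto_eLpNorm_one_of_tendsto_eLpNorm_two (fun k => (htr k).memLp.1) ?_
    have hb : MemLp (fun x => 1 + φ x) 2 (volume.restrict Ω) :=
      (memLp_const (1 : ℝ)).add hT.memLp
    refine tendsto_eLpNorm_two_of_dominated (fun k => (htr k).memLp.1) hb (fun k => ?_) ?_
    · filter_upwards [h.pos] with x hx
      rw [smoothShift_of_nonneg (hε k) hx.le, Real.norm_eq_abs]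
      exact abs_mul_log_add_le hx.le (hε k) (hε1 k) (hc k).le (hc1 k) (hεlog k)
    · filter_upwards [h.pos] with x hx
      have h1 : Tendsto (fun k => Real.log (smoothShift (ε k) (φ x))) atTop
          (𝓝 (Real.log (φ x))) := by
        have h2 : Tendsto (fun k => φ x + ε k) atTop (𝓝 (φ x)) := by
          simpa using hε0.const_add (φ x)
        refine (h2.log hx.ne').congr fun k => ?_
        rw [smoothShift_of_nonneg (hε k) hx.le]
      simpa using hc0.mul h1
  have hgr : Tendsto (fun k => eLpNorm
      (fun x => (c k) • deriv (fun s => Real.log (smoothShift (ε k) s)) (φ x) • g x) 1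
      (volume.restrict Ω)) atTop (𝓝 0) := by
    refine tendsto_eLpNorm_one_of_tendsto_eLpNorm_two (fun k => (htr k).memLp_gradient.1) ?_
    refine tendsto_of_tendsto_of_tendsto_of_le_of_le tendsto_const_nhds
      (h := fun k => ENNReal.ofReal (c k) * K) ?_ (fun _ => zero_le) fun k => ?_
    · simpa using ENNReal.Tendsto.mul_const (ENNReal.tendsto_ofReal hc0) (Or.inr hK)
    · refine le_trans (eLpNorm_le_mul_eLpNorm_of_ae_le_mul (c := c k) ?_ 2)
        (mul_le_mul_right (hKle (ε k) (hε k)) _)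
      filter_upwards [h.pos] with x hx
      rw [norm_smul, Real.norm_of_nonneg (hc k).le, deriv_log_smoothShift (hε k),
        deriv_smoothShift_of_pos (hε k) hx, smoothShift_of_nonneg (hε k) hx.le, one_div]
  have hnull : surfaceMeasure Ω {x | t x = 0} = 0 := by
    -- Markov's inequality at level 1: where t = 0 the k-th trace equals c log ε = -1.
    have hle : ∀ k, surfaceMeasure Ω {x | t x = 0} ≤
        C * (eLpNorm (fun x => c k * Real.log (smoothShift (ε k) (φ x))) 1 (volume.restrict Ω) +
          eLpNorm (fun x => (c k) • deriv (fun s => Real.log (smoothShift (ε k) s)) (φ x) • g x) 1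
            (volume.restrict Ω)) := by
      intro k
      refine le_trans ?_ (hCle _ _ _ (htr k))
      rw [eLpNorm_one_eq_lintegral_enorm]
      refine le_trans ?_ (mul_meas_ge_le_lintegral₀ (htr k).memLp_trace.1.enorm 1)
      rw [one_mul]
      refine measure_mono fun x hx => ?_
      have hx0 : t x = 0 := hx
      rw [Set.mem_ofPred_eq, hx0, smoothShift_of_nonneg (hε k) le_rfl, zero_add, hεlog]
      simp
    have hlim := ENNReal.Tendsto.const_mul (hu.add hgr) (Or.inr hC)
    simp only [add_zero, mul_zero] at hlim
    exact le_antisymm (ge_of_tendsto' hlim hle) zero_le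
  have hne : ∀ᵐ x ∂(surfaceMeasure Ω), t x ≠ 0 := by
    simpa [ae_iff] using hnull
  filter_upwards [hne, hT.trace_nonneg hn hΩ h.pos] with x hx hx'
  exact lt_of_le_of_ne hx' hx.symm

/-- Dominated convergence. Positivity of s is essential: where s = 0 the ratio stays 0 instead of
tending to 1. -/
theorem tendsto_integral_mul_div_add {μ : Measure (EuclideanSpace ℝ (Fin n))}
    {a s c : EuclideanSpace ℝ (Fin n) → ℝ} (hac : Integrable (fun x => a x * c x) μ)
    (ha : AEStronglyMeasurable a μ) (hcm : AEStronglyMeasurable c μ)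
    (hs : AEStronglyMeasurable s μ) (hc : ∀ x, 0 ≤ c x)
    (hpos : ∀ᵐ x ∂μ, 0 < s x) :
    Tendsto (fun k : ℕ => ∫ x, a x * (s x / (s x + 1 / ((k : ℝ) + 1)) * c x) ∂μ) atTop
      (𝓝 (∫ x, a x * c x ∂μ)) := by
  refine tendsto_integral_of_dominated_convergence (fun x => ‖a x * c x‖) (fun k => ?_) hac.norm
    (fun k => ?_) ?_
  · exact ha.mul (((hs.aemeasurable.div (hs.aemeasurable.add_const _)).aestronglyMeasurable).mul hcm)
  · filter_upwards [hpos] with x hx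
    refine (abs_div_add_mul_le hx.le (by positivity) (a x) (hc x)).trans_eq ?_
    rw [norm_mul, Real.norm_of_nonneg (hc x)]
  · filter_upwards [hpos] with x hx
    have h1 : Tendsto (fun k : ℕ => s x / (s x + 1 / ((k : ℝ) + 1))) atTop (𝓝 (s x / (s x + 0))) :=
      tendsto_const_nhds.div (tendsto_one_div_add_atTop_nhds_zero_nat.const_add _)
        (by simpa using hx.ne')
    rw [add_zero, div_self hx.ne'] at h1
    simpa using (h1.mul_const (c x)).const_mul (a x)

/-- Picone's inequality for smooth functions. -/
theorem IsPositiveRobinSolution.picone_of_contDiff (hn : 1 ≤ n) (hΩ : IsBoundedLipschitzDomain Ω)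
    (h : IsPositiveRobinSolution Ω m β Λ φ g t)
    (hm : MemLp m ⊤ (volume.restrict Ω)) (hβ : MemLp β ⊤ (surfaceMeasure Ω))
    {q : EuclideanSpace ℝ (Fin n) → ℝ} (hq : ContDiff ℝ ∞ q) :
    Λ * ∫ x in Ω, m x * q x ^ 2 ≤
      (∫ x in Ω, inner ℝ (∇ q x) (∇ q x)) + ∫ x, β x * q x ^ 2 ∂(surfaceMeasure Ω) := by
  have hq2 : Continuous fun x => q x ^ 2 := hq.continuous.pow 2
  have := hΩ.isFiniteMeasure_restrict
  have := hΩ.isFiniteMeasure_surfaceMeasure hn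
  have hqi := hΩ.memLp_of_continuous hq.continuous_gradient 2
  have h1 := tendsto_integral_mul_div_add (s := φ)
    (((hΩ.memLp_of_continuous hq2 1).mul hm).integrable le_rfl) hm.1
    hq2.aestronglyMeasurable h.hasSobolevTrace.memLp.1 (fun x => sq_nonneg (q x)) h.pos
  have h2 := tendsto_integral_mul_div_add (s := t)
    (((hΩ.memLp_surfaceMeasure_of_continuous hn hq2 1).mul hβ).integrable le_rfl) hβ.1
    hq2.aestronglyMeasurable h.hasSobolevTrace.memLp_trace.1 (fun x => sq_nonneg (q x))
    (h.trace_pos hn hΩ hm hβ)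
  refine le_of_tendsto_of_tendsto' (h1.const_mul Λ)
    (h2.const_add (∫ x in Ω, inner ℝ (∇ q x) (∇ q x))) fun k => ?_
  obtain ⟨hint, heq⟩ := h.integral_sq_div_add hn hΩ hq (ε := 1 / ((k : ℝ) + 1)) (by positivity)
  rw [← heq]
  refine add_le_add ?_ le_rfl
  refine integral_mono hint (hqi.integrable_inner hqi) fun x => ?_
  -- With v = q∇φ/(φ + ε), expanding |v - ∇q|² ≥ 0 gives 2v·∇q - |v|² ≤ |∇q|².
  have h3 := sq_nonneg ‖(q x / (φ x + 1 / ((k : ℝ) + 1))) • g x - ∇ q x‖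
  rw [norm_sub_sq_real, ← real_inner_self_eq_norm_sq (∇ q x)] at h3
  dsimp only
  linarith

/-- Picone's inequality: the quadratic form of the Robin problem is nonnegative when there is a
positive solution. -/
theorem IsPositiveRobinSolution.picone (hn : 1 ≤ n) (hΩ : IsBoundedLipschitzDomain Ω)
    (h : IsPositiveRobinSolution Ω m β Λ φ g t)
    (hm : MemLp m ⊤ (volume.restrict Ω)) (hβ : MemLp β ⊤ (surfaceMeasure Ω))
    {u t' : EuclideanSpace ℝ (Fin n) → ℝ} {g' : EuclideanSpace ℝ (Fin n) → EuclideanSpace ℝ (Fin n)}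
    (hu : HasSobolevTrace Ω u g' t') :
    Λ * ∫ x in Ω, m x * u x ^ 2 ≤
      (∫ x in Ω, inner ℝ (g' x) (g' x)) + ∫ x, β x * t' x ^ 2 ∂(surfaceMeasure Ω) := by
  obtain ⟨f, hf, hfu, hfg, hft⟩ := hu.exists_approx
  have hgm := fun k => hΩ.memLp_of_continuous (hf k).continuous_gradient 2
  have h1 := tendsto_integral_mul_sq hm (fun k => hΩ.memLp_of_continuous (hf k).continuous 2)
    hu.memLp hfu
  have h2 := tendsto_integral_inner_of_tendsto_eLpNorm hgm hu.memLp_gradient hgm hu.memLp_gradient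
    hfg hfg
  have h3 := tendsto_integral_mul_sq hβ
    (fun k => hΩ.memLp_surfaceMeasure_of_continuous hn (hf k).continuous 2) hu.memLp_trace hft
  exact le_of_tendsto_of_tendsto' (h1.const_mul Λ) (h2.add h3) fun k =>
    h.picone_of_contDiff hn hΩ hm hβ (hf k)

end Robin

/-! ### Comparison of the principal eigenvalues -/

theorem mainTheorem3 {n : ℕ} (hn : 1 ≤ n) (Ω : Set (EuclideanSpace ℝ (Fin n)))
    (hΩ : IsBoundedLipschitzDomain Ω)
    (κ : ℝ) (hκ : 0 < κ) (m : EuclideanSpace ℝ (Fin n) → ℝ) (hm : IsIndefiniteWeight Ω m κ)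
    (β₁ β₂ : EuclideanSpace ℝ (Fin n) → ℝ)
    (hβ₁ : MemLp β₁ ⊤ (surfaceMeasure Ω)) (hβ₂ : MemLp β₂ ⊤ (surfaceMeasure Ω))
    (Λ₁ Λ₂ : ℝ) (φ₁ φ₂ : EuclideanSpace ℝ (Fin n) → ℝ)
    (h₁ : IsPrincipalEigenpair Ω m β₁ Λ₁ φ₁) (h₂ : IsPrincipalEigenpair Ω m β₂ Λ₂ φ₂)
    (hmφ : 0 < ∫ x in Ω, m x * φ₁ x ^ 2)
    (hβ : ∀ᵐ x ∂(surfaceMeasure Ω), β₂ x ≤ β₁ x) :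
    Λ₂ ≤ Λ₁ ∧
      ∀ t₁ : EuclideanSpace ℝ (Fin n) → ℝ, IsTrace Ω φ₁ t₁ →
        0 < surfaceMeasure Ω {x | β₂ x < β₁ x ∧ t₁ x ≠ 0} → Λ₂ < Λ₁ := by
  obtain ⟨g₁, s₁, hs₁⟩ := h₁.exists_isPositiveRobinSolution hΩ
  obtain ⟨g₂, s₂, hs₂⟩ := h₂.exists_isPositiveRobinSolution hΩ
  have hm' : MemLp m ⊤ (volume.restrict Ω) := by
    refine memLp_top_of_bound hm.aemeasurable.aestronglyMeasurable (max 1 κ) ?_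
    filter_upwards [hm.bounds] with x hx
    exact abs_le.2 ⟨by linarith [le_max_left 1 κ, hx.1], hx.2.trans (le_max_right _ _)⟩
  have hT := hs₁.hasSobolevTrace
  have hint : ∀ {b : EuclideanSpace ℝ (Fin n) → ℝ}, MemLp b ⊤ (surfaceMeasure Ω) →
      Integrable (fun x => b x * s₁ x ^ 2) (surfaceMeasure Ω) := fun hb => by
    have := (hT.memLp_trace.mul hb).integrable_mul hT.memLp_trace (p := 2) (q := 2)
    refine this.congr (Eventually.of_forall fun x => ?_)
    simp only [Pi.mul_apply]
    ring
  -- Picone's inequality for the second problem is applied to φ₁, and the first equation is tested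
  -- with φ₁; both contain the same Dirichlet energy, which cancels.
  have hpic := hs₂.picone hn hΩ hm' hβ₂ hT
  have heq := hs₁.integral_eq _ _ _ hT
  simp only [mul_assoc, ← pow_two] at heq
  have hdiff : ∫ x, (β₁ x - β₂ x) * s₁ x ^ 2 ∂(surfaceMeasure Ω) ≤
      (Λ₁ - Λ₂) * ∫ x in Ω, m x * φ₁ x ^ 2 := by
    simp only [sub_mul]
    rw [integral_sub (hint hβ₁) (hint hβ₂)]
    linarith
  have hnonneg : 0 ≤ᵐ[surfaceMeasure Ω] fun x => (β₁ x - β₂ x) * s₁ x ^ 2 := by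
    filter_upwards [hβ] with x hx
    exact mul_nonneg (sub_nonneg.2 hx) (sq_nonneg _)
  refine ⟨sub_nonneg.1 (nonneg_of_mul_nonneg_left ((integral_nonneg_of_ae hnonneg).trans hdiff)
    hmφ), fun t₁ ht₁ hpos => ?_⟩
  -- The trace in the conclusion is arbitrary, so it has to be identified with the one used in the
  -- estimate.
  have ht : s₁ =ᵐ[surfaceMeasure Ω] t₁ :=
    hT.trace_unique hn hΩ (ht₁.hasSobolevTrace hΩ (hT.hasH1Gradient hΩ))
  have hint' : Integrable (fun x => (β₁ x - β₂ x) * s₁ x ^ 2) (surfaceMeasure Ω) := by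
    simp only [sub_mul]
    exact (hint hβ₁).sub (hint hβ₂)
  have hstrict : 0 < ∫ x, (β₁ x - β₂ x) * s₁ x ^ 2 ∂(surfaceMeasure Ω) := by
    -- A nonnegative integrand has positive integral once its support has positive measure, and up
    -- to a null set the support contains the given set.
    rw [integral_pos_iff_support_of_nonneg_ae hnonneg hint']
    refine hpos.trans_le (measure_mono_ae ?_)
    filter_upwards [ht] with x hx hmem
    have hmem' : β₂ x < β₁ x ∧ t₁ x ≠ 0 := hmem
    have hne : s₁ x ≠ 0 := by
      rw [hx]
      exact hmem'.2
    exact mul_ne_zero (sub_pos.2 hmem'.1).ne' (pow_ne_zero 2 hne)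
  exact sub_pos.1 (pos_of_mul_pos_left (hstrict.trans_le hdiff) hmφ.le)
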